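/- (Watson's identity.) For a complex number $q$ with $|q|<1$, write $(x;q)_n=\prod_{i=0}^{n-1}(1-q^ix)$ and $J_a=J_a(q)=\prod_{i\ge 1}(1-q^{ai})$ for positive integers $a$, and let $$f_3(q)=\sum_{n\ge 0}\frac{q^{n^2}}{(-q;q)_n^2},\qquad \omega_3(q)=\sum_{n\ge 0}\frac{q^{2n(n+1)}}{(q;q^2)_{n+1}^2}$$ be third-order mock theta functions. Then, for every complex $q$ with $|q|<1$, the series defining $f_3(q^8)$, $\omega_3(q)$ and $\omega_3(-q^4)$ converge absolutely and have nonvanishing denominators, the products $J_a$ converge to nonzero values, and $$f_3(q^8)+2q\,\omega_3(q)+2q^3\,\omega_3(-q^4)=\frac{J_2J_4^6}{J_1^2J_8^4}.$$ -/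

import Mathlib

open scoped BigOperators

noncomputable section

/-- The finite `q`-Pochhammer symbol `(x; q)_n = ∏_{i=0}^{n-1} (1 - q^i x)`. -/
def qPochhammer (x q : ℂ) (n : ℕ) : ℂ :=
  ∏ i ∈ Finset.range n, (1 - q ^ i * x)

/-- The `n`-th term `q^{n^2} / (-q; q)_n^2` of the third-order mock theta function `f₃`. -/
def f3Term (q : ℂ) (n : ℕ) : ℂ :=
  q ^ (n ^ 2) / qPochhammer (-q) q n ^ 2

/-- The third-order mock theta function `f₃(q) = ∑_{n ≥ 0} q^{n^2} / (-q; q)_n^2`. -/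
def mockF3 (q : ℂ) : ℂ :=
  ∑' n : ℕ, f3Term q n

/-- The `n`-th term `q^{2n(n+1)} / (q; q^2)_{n+1}^2` of the third-order mock theta
function `ω₃`. -/
def omega3Term (q : ℂ) (n : ℕ) : ℂ :=
  q ^ (2 * n * (n + 1)) / qPochhammer q (q ^ 2) (n + 1) ^ 2

/-- The third-order mock theta function
`ω₃(q) = ∑_{n ≥ 0} q^{2n(n+1)} / (q; q^2)_{n+1}^2`. -/
def mockOmega3 (q : ℂ) : ℂ :=
  ∑' n : ℕ, omega3Term q n

/-- The factor `1 - q^{a(i+1)}` of the product `J_a`. -/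
def eulerFactor (a : ℕ) (q : ℂ) (i : ℕ) : ℂ :=
  1 - q ^ (a * (i + 1))

/-- `J_a = J_a(q) = ∏_{i ≥ 1} (1 - q^{a i})`. -/
def eulerJ (a : ℕ) (q : ℂ) : ℂ :=
  ∏' i : ℕ, eulerFactor a q i

end

noncomputable section

/-! Both sides are related to one partial fraction expansion. Let θ(x; p) = (x; p)_∞ (p/x; p)_∞. As
a function of x, the reciprocal of x θ(b₀x; q²) θ(b₁x; q²) θ(b₂x; q²) has simple poles at the points
b_i x q^{2k} = 1 and equals the sum of its principal parts, that is, a combination of three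
Appell–Lerch series (`inv_prod_thetaProd`). No complex analysis is needed: the truncated products
are rational functions, Lagrange interpolation gives their partial fractions, and dominated
convergence gives the limit.

The choice b = (1, iq, -iq), x = q turns the left side into an infinite product. The series for b₀
is the Appell–Lerch series of ω₃(q). The series for ±iq are added and split by the parity of k: the
even terms give the series of ω₃(-q⁴), the odd ones that of f₃(q⁸) (`tsum_I_families`). Elementary
product rules then bring all constants to the J_a.

The Appell–Lerch forms of f₃ and ω₃ (`tsum_universal_mock_theta`) use the same partial fractions,
now for each summand 1/((x; p)_{n+1} (p/x; p)_{n+e}). After exchanging the sums, the sum over n at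
fixed k is a Durfee rectangle series with value p^{k(k+e)}/(p; p)_∞ (`tsum_bailey_weight`). -/

/-! ### Partial fractions over finite q-products -/

/-- Partial fractions for a monomial over a product of distinct linear factors. -/
lemma pow_div_prod_one_sub {ι : Type*} [DecidableEq ι] (s : Finset ι) (v : ι → ℂ)
    (hv : ∀ i ∈ s, v i ≠ 0) (hinj : Set.InjOn v s) {m : ℕ} (hm : m < s.card) {y : ℂ}
    (hy : ∀ i ∈ s, 1 - y * v i ≠ 0) :
    y ^ m / ∏ i ∈ s, (1 - y * v i) =
      ∑ i ∈ s, (v i ^ m * ∏ j ∈ s.erase i, (1 - v j / v i))⁻¹ / (1 - y * v i) := by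
  have hinj' : Set.InjOn (fun i => (v i)⁻¹) s := fun a ha b hb h =>
    hinj ha hb (inv_injective h)
  have hyn : ∀ i ∈ s, y ≠ (v i)⁻¹ := by
    intro i hi h
    apply hy i hi
    rw [h, inv_mul_cancel₀ (hv i hi), sub_self]
  have hdeg : (Polynomial.X ^ m : Polynomial ℂ).degree < s.card := by
    rw [Polynomial.degree_X_pow]; exact_mod_cast hm
  -- Since m is below the number of nodes, X ^ m is its own interpolant at the poles 1 / v i;
  -- dividing by the nodal polynomial gives the partial fractions.
  have h1 := Lagrange.eq_interpolate hinj' hdeg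
  have h2 := congrArg (Polynomial.eval y) h1
  rw [Lagrange.eval_interpolate_not_at_node _ hyn, Lagrange.eval_nodal] at h2
  simp only [Polynomial.eval_pow, Polynomial.eval_X] at h2
  have hP : ∏ i ∈ s, (1 - y * v i) ≠ 0 := Finset.prod_ne_zero_iff.2 hy
  rw [div_eq_iff hP, h2, mul_comm, Finset.sum_mul, Finset.sum_mul]
  refine Finset.sum_congr rfl fun i hi => ?_
  have hprod : ∏ j ∈ s, (1 - y * v j) = (∏ j ∈ s, (y - (v j)⁻¹)) * ∏ j ∈ s, (-v j) := by
    rw [← Finset.prod_mul_distrib]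
    refine Finset.prod_congr rfl fun j hj => ?_
    have := hv j hj
    field_simp
    ring
  rw [hprod, Lagrange.nodalWeight]
  have hw : ∏ j ∈ s.erase i, (1 - v j / v i) =
      (∏ j ∈ s.erase i, ((v i)⁻¹ - (v j)⁻¹)) * ∏ j ∈ s.erase i, (-v j) := by
    rw [← Finset.prod_mul_distrib]
    refine Finset.prod_congr rfl fun j hj => ?_
    have := hv j (Finset.mem_of_mem_erase hj)
    have := hv i hi
    field_simp
    ring
  have hne : ∏ j ∈ s.erase i, (-v j) ≠ 0 := Finset.prod_ne_zero_iff.2 fun j hj =>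
    neg_ne_zero.2 (hv j (Finset.mem_of_mem_erase hj))
  have hvi := hv i hi
  have hyi := hy i hi
  have hyv : y - (v i)⁻¹ ≠ 0 := sub_ne_zero.2 (hyn i hi)
  have hne2 : ∏ j ∈ s.erase i, ((v i)⁻¹ - (v j)⁻¹) ≠ 0 := by
    refine Finset.prod_ne_zero_iff.2 fun j hj => sub_ne_zero.2 fun h => ?_
    exact (Finset.ne_of_mem_erase hj) (hinj (Finset.mem_of_mem_erase hj) hi (inv_injective h.symm))
  rw [hw, ← Finset.mul_prod_erase s (fun j => -v j) hi, Finset.prod_inv_distrib]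
  have : 1 - y * v i = -(v i) * (y - (v i)⁻¹) := by field_simp; ring
  rw [this, inv_pow]
  generalize (∏ j ∈ s.erase i, ((v i)⁻¹ - (v j)⁻¹)) = A at *
  generalize (∏ j ∈ s, (y - (v j)⁻¹)) = B at *
  generalize (∏ j ∈ s.erase i, (-v j)) = D at *
  generalize y - (v i)⁻¹ = E at *
  field_simp

lemma qPochhammer_zero (x q : ℂ) : qPochhammer x q 0 = 1 := by simp [qPochhammer]

lemma qPochhammer_succ (x q : ℂ) (n : ℕ) :
    qPochhammer x q (n + 1) = qPochhammer x q n * (1 - q ^ n * x) := by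
  simp [qPochhammer, Finset.prod_range_succ]

lemma qPochhammer_succ' (x q : ℂ) (n : ℕ) :
    qPochhammer x q (n + 1) = (1 - x) * qPochhammer (q * x) q n := by
  simp only [qPochhammer, Finset.prod_range_succ', pow_zero, one_mul]
  rw [mul_comm]
  congr 1
  refine Finset.prod_congr rfl fun i _ => ?_
  ring

lemma qPochhammer_ne_zero {x q : ℂ} (h : ∀ i : ℕ, 1 - q ^ i * x ≠ 0) (n : ℕ) :
    qPochhammer x q n ≠ 0 := Finset.prod_ne_zero_iff.2 fun i _ => h i

/-- Shifting the argument of a finite `q`-Pochhammer symbol down by `q ^ (2 j)`. -/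
lemma qPochhammer_shift {r β : ℂ} (hr : r ≠ 0) (hβ : β ≠ 0) (j M : ℕ) :
    r ^ (j * (j + 1)) * qPochhammer (β / (r ^ 2) ^ j) (r ^ 2) (j + M) =
      (-β) ^ j * qPochhammer (r ^ 2 / β) (r ^ 2) j * qPochhammer β (r ^ 2) M := by
  induction j with
  | zero => simp [qPochhammer_zero]
  | succ j ih =>
    rw [show j + 1 + M = (j + M) + 1 by ring, qPochhammer_succ', qPochhammer_succ,
      show r ^ 2 * (β / (r ^ 2) ^ (j + 1)) = β / (r ^ 2) ^ j by field_simp; ring,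
      show r ^ ((j + 1) * (j + 1 + 1)) = r ^ (j * (j + 1)) * (r ^ 2) ^ (j + 1) by ring]
    -- Each factor with a negative power of r² is reflected: 1 - β/p^s = -(β/p^s)(1 - p^s/β).
    have h : (r ^ 2) ^ (j + 1) * (1 - β / (r ^ 2) ^ (j + 1)) =
        -β * (1 - (r ^ 2) ^ j * (r ^ 2 / β)) := by field_simp; ring
    calc _ = (r ^ 2) ^ (j + 1) * (1 - β / (r ^ 2) ^ (j + 1)) *
          (r ^ (j * (j + 1)) * qPochhammer (β / (r ^ 2) ^ j) (r ^ 2) (j + M)) := by ring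
      _ = _ := by rw [ih, h]; ring

/-- This is the part of a residue coming from the pole's own string of nodes. Nodes below j are
reflected by `qPochhammer_shift` with β = 1; nodes above j already form a Pochhammer symbol. -/
lemma prod_range_erase_one_sub {r : ℂ} (hr : r ≠ 0) {j L : ℕ} (hj : j < L) :
    r ^ (j * (j + 1)) * ∏ i ∈ (Finset.range L).erase j, (1 - (r ^ 2) ^ i / (r ^ 2) ^ j) =
      (-1) ^ j * qPochhammer (r ^ 2) (r ^ 2) j * qPochhammer (r ^ 2) (r ^ 2) (L - 1 - j) := by
  obtain ⟨M, rfl⟩ : ∃ M, L = j + 1 + M := ⟨L - (j + 1), by omega⟩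
  have hs : (Finset.range (j + 1 + M)).erase j =
      (Finset.range j) ∪ (Finset.range M).image (fun i => j + 1 + i) := by
    ext a
    simp only [Finset.mem_erase, Finset.mem_range, Finset.mem_union, Finset.mem_image]
    constructor
    · rintro ⟨h1, h2⟩
      by_cases h : a < j
      · exact Or.inl h
      · exact Or.inr ⟨a - (j + 1), by omega, by omega⟩
    · rintro (h | ⟨b, hb, rfl⟩) <;> constructor <;> omega
  have hd : Disjoint (Finset.range j) ((Finset.range M).image (fun i => j + 1 + i)) := by
    rw [Finset.disjoint_left]
    intro a ha hb
    simp only [Finset.mem_range, Finset.mem_image] at ha hb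
    obtain ⟨b, _, rfl⟩ := hb
    omega
  rw [hs, Finset.prod_union hd, Finset.prod_image (by intro a _ b _ h; simpa using h)]
  have h1 := qPochhammer_shift hr one_ne_zero j 0
  simp only [qPochhammer_zero, mul_one, div_one, add_zero] at h1
  have h2 : ∏ i ∈ Finset.range j, (1 - (r ^ 2) ^ i / (r ^ 2) ^ j) =
      qPochhammer (1 / (r ^ 2) ^ j) (r ^ 2) j := by
    refine Finset.prod_congr rfl fun i _ => ?_
    ring
  have h3 : ∏ i ∈ Finset.range M, (1 - (r ^ 2) ^ (j + 1 + i) / (r ^ 2) ^ j) =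
      qPochhammer (r ^ 2) (r ^ 2) M := by
    refine Finset.prod_congr rfl fun i _ => ?_
    rw [pow_add, pow_succ]
    field_simp
  rw [h2, h3, show j + 1 + M - 1 - j = M by omega, ← mul_assoc, h1]

/-- Partial fractions for a monomial over a product of finitely many `q`-Pochhammer symbols. -/
lemma pow_div_prod_qPochhammer {ι : Type*} [Fintype ι] [DecidableEq ι] {q : ℂ} (hq : q ≠ 0)
    (b : ι → ℂ) (hb : ∀ i, b i ≠ 0) (L : ℕ)
    (hinj : ∀ i j k l, b i * q ^ k = b j * q ^ l → i = j ∧ k = l) {m : ℕ}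
    (hm : m < Fintype.card ι * L) {y : ℂ} (hy : ∀ i, ∀ k < L, 1 - y * (b i * q ^ k) ≠ 0) :
    y ^ m / ∏ i, qPochhammer (b i * y) q L =
      ∑ i, ∑ k ∈ Finset.range L, ((b i * q ^ k) ^ m *
        ((∏ l ∈ (Finset.range L).erase k, (1 - q ^ l / q ^ k)) *
          ∏ j ∈ Finset.univ.erase i, qPochhammer (b j / b i / q ^ k) q L))⁻¹ /
            (1 - y * (b i * q ^ k)) := by
  have key := pow_div_prod_one_sub (Finset.univ ×ˢ Finset.range L)
    (fun a : ι × ℕ => b a.1 * q ^ a.2)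
    (fun a _ => mul_ne_zero (hb _) (pow_ne_zero _ hq))
    (fun a _ c _ h => Prod.ext (hinj _ _ _ _ h).1 (hinj _ _ _ _ h).2)
    (m := m) (by simpa using hm) (y := y)
    (fun a ha => hy _ _ (by simpa using ha))
  rw [Finset.prod_product, Finset.sum_product] at key
  have e1 : ∏ i, qPochhammer (b i * y) q L =
      ∏ i, ∏ k ∈ Finset.range L, (1 - y * (b i * q ^ k)) := by
    refine Finset.prod_congr rfl fun i _ => Finset.prod_congr rfl fun k _ => ?_
    ring
  rw [e1, key]
  refine Finset.sum_congr rfl fun i _ => Finset.sum_congr rfl fun k hk => ?_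
  -- The other nodes are the rest of the string of b i and the full strings of the other parameters.
  have hs : (Finset.univ ×ˢ Finset.range L).erase (i, k) =
      ({i} ×ˢ (Finset.range L).erase k) ∪ ((Finset.univ.erase i) ×ˢ Finset.range L) := by
    ext ⟨a, c⟩
    simp only [Finset.mem_erase, Finset.mem_union, Finset.mem_product, Finset.mem_univ,
      Finset.mem_singleton, ne_eq, Prod.mk.injEq]
    tauto
  have hd : Disjoint ({i} ×ˢ (Finset.range L).erase k)
      ((Finset.univ.erase i) ×ˢ Finset.range L) := by
    rw [Finset.disjoint_left]
    rintro ⟨a, c⟩ h1 h2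
    simp only [Finset.mem_erase, Finset.mem_product, Finset.mem_univ,
      Finset.mem_singleton, ne_eq] at h1 h2
    exact h2.1.1 h1.1
  have hbi := hb i
  rw [hs, Finset.prod_union hd, Finset.prod_product, Finset.prod_product, Finset.prod_singleton]
  congr 4
  · refine Finset.prod_congr rfl fun l _ => ?_
    field_simp
  · refine Finset.prod_congr rfl fun j _ => Finset.prod_congr rfl fun l _ => ?_
    field_simp

/-! ### Infinite products and uniform bounds -/

/-- The infinite `q`-Pochhammer symbol `(x; q)_∞`. -/
def qPochhammerInf (x q : ℂ) : ℂ := ∏' i : ℕ, (1 - q ^ i * x)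

lemma summable_norm_pow_mul {q : ℂ} (hq : ‖q‖ < 1) (x : ℂ) :
    Summable fun i : ℕ => ‖-(q ^ i * x)‖ := by
  simpa using (summable_geometric_of_lt_one (norm_nonneg q) hq).mul_right ‖x‖

lemma multipliable_one_sub_pow_mul {q : ℂ} (hq : ‖q‖ < 1) (x : ℂ) :
    Multipliable fun i : ℕ => 1 - q ^ i * x := by
  simpa [sub_eq_add_neg] using multipliable_one_add_of_summable (summable_norm_pow_mul hq x)

lemma tendsto_qPochhammer {q : ℂ} (hq : ‖q‖ < 1) (x : ℂ) :
    Filter.Tendsto (qPochhammer x q) Filter.atTop (nhds (qPochhammerInf x q)) :=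
  (multipliable_one_sub_pow_mul hq x).hasProd.tendsto_prod_nat

lemma qPochhammerInf_ne_zero {x q : ℂ} (hq : ‖q‖ < 1) (h : ∀ i : ℕ, 1 - q ^ i * x ≠ 0) :
    qPochhammerInf x q ≠ 0 := by
  have := tprod_one_add_ne_zero_of_summable (f := fun i : ℕ => -(q ^ i * x))
    (fun i => by simpa [sub_eq_add_neg] using h i) (summable_norm_pow_mul hq x)
  simpa [qPochhammerInf, sub_eq_add_neg] using this

lemma qPochhammerInf_eq_one_sub_mul {q : ℂ} (hq : ‖q‖ < 1) (x : ℂ) :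
    qPochhammerInf x q = (1 - x) * qPochhammerInf (q * x) q := by
  refine tendsto_nhds_unique ((tendsto_qPochhammer hq x).comp (Filter.tendsto_add_atTop_nat 1)) ?_
  simp only [Function.comp_def, qPochhammer_succ']
  exact (tendsto_qPochhammer hq (q * x)).const_mul _

/-- The finite symbols converge to a nonzero limit, so their inverses form a convergent, hence
bounded, sequence. -/
lemma exists_norm_inv_qPochhammer_le {x q : ℂ} (hq : ‖q‖ < 1) (h : ∀ i : ℕ, 1 - q ^ i * x ≠ 0) :
    ∃ C : ℝ, 0 < C ∧ ∀ n, ‖(qPochhammer x q n)⁻¹‖ ≤ C := by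
  have ht := (tendsto_qPochhammer hq x).inv₀ (qPochhammerInf_ne_zero hq h)
  obtain ⟨C, hC⟩ := (Metric.isBounded_range_of_tendsto _ ht).exists_norm_le
  refine ⟨max C 1, by positivity, fun n => ?_⟩
  exact (hC _ ⟨n, rfl⟩).trans (le_max_left _ _)

lemma one_sub_pow_mul_ne_zero_of_norm_lt {q : ℂ} (hq : ‖q‖ < 1) {x : ℂ} (hx : ‖x‖ < 1) (i : ℕ) :
    1 - q ^ i * x ≠ 0 := by
  intro h
  have h1 : ‖q ^ i * x‖ = 1 := by rw [← sub_eq_zero.1 h, norm_one]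
  rw [norm_mul, norm_pow] at h1
  have h2 : ‖q‖ ^ i ≤ 1 := pow_le_one₀ (norm_nonneg _) hq.le
  nlinarith [norm_nonneg x]

/-- For x ≠ 0 the inverse tends to 1 as k → ∞ and to 0 as k → -∞. A vanishing denominator does no
harm, because its inverse is 0 by convention. -/
lemma exists_norm_inv_one_sub_zpow_le {q : ℂ} (hq0 : q ≠ 0) (hq : ‖q‖ < 1) (x : ℂ) :
    ∃ C : ℝ, 0 < C ∧ ∀ k : ℤ, ‖(1 - x * q ^ k)⁻¹‖ ≤ C := by
  by_cases hx : x = 0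
  · exact ⟨1, one_pos, fun k => by simp [hx]⟩
  have h1 : Filter.Tendsto (fun n : ℕ => (1 - x * q ^ n)⁻¹) Filter.atTop (nhds 1) := by
    have := ((tendsto_pow_atTop_nhds_zero_of_norm_lt_one hq).const_mul x).const_sub 1
    simpa using this.inv₀ (by simp)
  have h2 : Filter.Tendsto (fun n : ℕ => (1 - x * q ^ (-(n : ℤ)))⁻¹) Filter.atTop (nhds 0) := by
    have h3 : Filter.Tendsto (fun n : ℕ => q ^ n / (q ^ n - x)) Filter.atTop (nhds (0 / (0 - x))) :=
      (tendsto_pow_atTop_nhds_zero_of_norm_lt_one hq).div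
        ((tendsto_pow_atTop_nhds_zero_of_norm_lt_one hq).sub_const x) (by simpa using hx)
    rw [zero_div] at h3
    refine h3.congr fun n => ?_
    have : q ^ n ≠ 0 := pow_ne_zero _ hq0
    rw [zpow_neg, zpow_natCast, ← one_div, ← div_eq_mul_inv, one_sub_div this, one_div_div]
  obtain ⟨C, hC⟩ := (Metric.isBounded_range_of_tendsto _ h1).exists_norm_le
  obtain ⟨D, hD⟩ := (Metric.isBounded_range_of_tendsto _ h2).exists_norm_le
  refine ⟨max (max C D) 1, by positivity, fun k => ?_⟩
  obtain ⟨n, rfl | rfl⟩ := k.eq_nat_or_neg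
  · exact (hC _ ⟨n, by simp⟩).trans ((le_max_left _ _).trans (le_max_left _ _))
  · exact (hD _ ⟨n, rfl⟩).trans ((le_max_right _ _).trans (le_max_left _ _))

lemma summable_pow_sq_mul_pow {ρ d : ℝ} (hρ0 : 0 ≤ ρ) (hρ : ρ < 1) (hd : 0 ≤ d) :
    Summable fun n : ℕ => ρ ^ (n ^ 2) * d ^ n := by
  have h : Filter.Tendsto (fun n : ℕ => ρ ^ n * d) Filter.atTop (nhds 0) := by
    simpa using (tendsto_pow_atTop_nhds_zero_of_lt_one hρ0 hρ).mul_const d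
  have h1 : ∀ᶠ n : ℕ in Filter.atTop, ρ ^ n * d ≤ 1 / 2 :=
    (h.eventually (gt_mem_nhds (by norm_num : (0 : ℝ) < 1 / 2))).mono fun n hn => hn.le
  refine Summable.of_norm_bounded_eventually_nat
    (summable_geometric_of_lt_one (by norm_num : (0 : ℝ) ≤ 1 / 2) (by norm_num)) ?_
  filter_upwards [h1] with n hn
  rw [Real.norm_of_nonneg (by positivity), pow_two, pow_mul, ← mul_pow]
  exact pow_le_pow_left₀ (by positivity) hn n

lemma summable_zpow_sq_mul_zpow {ρ d : ℝ} (hρ0 : 0 < ρ) (hρ : ρ < 1) (hd : 0 < d) :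
    Summable fun k : ℤ => ρ ^ (k ^ 2) * d ^ k := by
  refine Summable.of_nat_of_neg ?_ ?_
  · refine (summable_pow_sq_mul_pow hρ0.le hρ hd.le).congr fun n => ?_
    rw [zpow_natCast]; norm_cast
  · refine (summable_pow_sq_mul_pow hρ0.le hρ (inv_pos.2 hd).le).congr fun n => ?_
    rw [zpow_neg, zpow_natCast, neg_sq, inv_pow]; norm_cast

lemma summable_norm_zpow_quadratic {r c : ℂ} (hr0 : r ≠ 0) (hr : ‖r‖ < 1) (hc : c ≠ 0) {a : ℕ}
    (ha : 0 < a) (b : ℤ) : Summable fun k : ℤ => ‖r ^ (a * k ^ 2 + b * k) * c ^ k‖ := by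
  have h := summable_zpow_sq_mul_zpow (ρ := ‖r‖ ^ a) (d := ‖r‖ ^ b * ‖c‖)
    (pow_pos (norm_pos_iff.2 hr0) _) (pow_lt_one₀ (norm_nonneg _) hr ha.ne')
    (mul_pos (zpow_pos (norm_pos_iff.2 hr0) _) (norm_pos_iff.2 hc))
  refine h.congr fun k => ?_
  rw [norm_mul, norm_zpow, norm_zpow, zpow_add₀ (norm_ne_zero_iff.2 hr0), mul_zpow, ← zpow_mul,
    zpow_mul ‖r‖ (a : ℤ), zpow_natCast, mul_assoc]

lemma tendsto_toNat_add (k : ℤ) :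
    Filter.Tendsto (fun N : ℕ => ((N : ℤ) + k).toNat) Filter.atTop Filter.atTop := by
  refine Filter.tendsto_atTop.2 fun b => ?_
  filter_upwards [Filter.eventually_ge_atTop (b + k.natAbs)] with N hN
  omega

/-- Centring the finite sums and extending them by zero to ℤ puts them on one index set, as
dominated convergence requires. -/
lemma sum_range_eq_tsum_int (F : ℤ → ℂ) (a b : ℕ) :
    ∑ j ∈ Finset.range (a + b), F ((j : ℤ) - a) =
      ∑' k : ℤ, if -(a : ℤ) ≤ k ∧ k < b then F k else 0 := by
  rw [tsum_eq_sum (s := Finset.Ico (-(a : ℤ)) b)]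
  · refine Finset.sum_nbij' (fun j => (j : ℤ) - a) (fun k => (k + a).toNat) ?_ ?_ ?_ ?_ ?_
    · intro j hj; simp only [Finset.mem_range, Finset.mem_Ico] at *; omega
    · intro j hj; simp only [Finset.mem_range, Finset.mem_Ico] at *; omega
    · intro j hj; simp only [Finset.mem_range] at *; omega
    · intro j hj; simp only [Finset.mem_Ico] at *; omega
    · intro j hj
      simp only [Finset.mem_range] at hj
      rw [if_pos (by omega)]
  · intro k hk
    rw [Finset.mem_Ico] at hk
    rw [if_neg hk]

lemma pow_injective_of_norm_lt_one {q : ℂ} (hq0 : q ≠ 0) (hq : ‖q‖ < 1) :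
    Function.Injective fun n : ℕ => q ^ n := by
  intro k l h
  refine pow_right_injective₀ (norm_pos_iff.2 hq0) hq.ne ?_
  simpa using congrArg norm h

lemma norm_sq_lt_one {r : ℂ} (hr : ‖r‖ < 1) : ‖r ^ 2‖ < 1 := by
  rw [norm_pow]; exact pow_lt_one₀ (norm_nonneg _) hr two_ne_zero

/-! ### Reciprocals of theta products, truncated and in the limit -/

/-- Partial fractions for `1 / ((x; r²)_{n+1} (r²/x; r²)_{n+e})`. -/
lemma inv_qPochhammer_mul_qPochhammer {r x : ℂ} (hr0 : r ≠ 0) (hr : ‖r‖ < 1) (hx0 : x ≠ 0)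
    (hx : ∀ k : ℤ, 1 - x * (r ^ 2) ^ k ≠ 0) (n e : ℕ) :
    (qPochhammer x (r ^ 2) (n + 1) * qPochhammer (r ^ 2 / x) (r ^ 2) (n + e))⁻¹ =
      ∑' k : ℤ, if -((n + e : ℕ) : ℤ) ≤ k ∧ k < (n + 1 : ℕ) then
        (-1) ^ k * r ^ (k * (k + 1)) / (qPochhammer (r ^ 2) (r ^ 2) ((n + e : ℕ) + k).toNat *
          qPochhammer (r ^ 2) (r ^ 2) ((n : ℤ) - k).toNat) / (1 - x * (r ^ 2) ^ k) else 0 := by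
  rw [← sum_range_eq_tsum_int (fun k => (-1) ^ k * r ^ (k * (k + 1)) /
      (qPochhammer (r ^ 2) (r ^ 2) ((n + e : ℕ) + k).toNat *
          qPochhammer (r ^ 2) (r ^ 2) ((n : ℤ) - k).toNat) / (1 - x * (r ^ 2) ^ k))]
  have hp0 : r ^ 2 ≠ 0 := pow_ne_zero 2 hr0
  have hp := norm_sq_lt_one hr
  set a := n + e with ha
  have hden : ∀ k : ℕ, 1 - x / (r ^ 2) ^ a * ((1 : ℂ) * (r ^ 2) ^ k) =
      1 - x * (r ^ 2) ^ ((k : ℤ) - a) := by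
    intro k
    rw [zpow_sub₀ hp0, zpow_natCast, zpow_natCast]
    ring
  -- Evaluation at y = x / p^a moves the a reflected factors into (p/x; p)_a. The exponent m = a
  -- cancels the x^a that the reflection produces.
  have key := pow_div_prod_qPochhammer hp0 (fun _ : Unit => (1 : ℂ)) (fun _ => one_ne_zero)
    (a + (n + 1)) (fun i j k l h => ⟨rfl, pow_injective_of_norm_lt_one hp0 hp (by simpa using h)⟩)
    (m := a) (by simp) (y := x / (r ^ 2) ^ a)
    (fun i k _ => by rw [hden]; exact hx _)
  simp only [one_mul] at hden
  simp only [Finset.univ_unique, Finset.prod_singleton, Finset.sum_singleton, one_mul,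
    Finset.erase_singleton, Finset.prod_empty, mul_one, hden] at key
  have hshift := qPochhammer_shift hr0 hx0 a (n + 1)
  have hra : r ^ (a * (a + 1)) ≠ 0 := pow_ne_zero _ hr0
  have hA : qPochhammer (x / (r ^ 2) ^ a) (r ^ 2) (a + (n + 1)) =
      (-x) ^ a * (qPochhammer x (r ^ 2) (n + 1) * qPochhammer (r ^ 2 / x) (r ^ 2) a) /
        r ^ (a * (a + 1)) := by
    rw [eq_div_iff hra, mul_comm, hshift]; ring
  have hL : (qPochhammer x (r ^ 2) (n + 1) * qPochhammer (r ^ 2 / x) (r ^ 2) a)⁻¹ =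
      (-1) ^ a * ((r ^ 2) ^ a) ^ a / r ^ (a * (a + 1)) *
        ((x / (r ^ 2) ^ a) ^ a / qPochhammer (x / (r ^ 2) ^ a) (r ^ 2) (a + (n + 1))) := by
    rw [hA, neg_pow x a, div_pow]
    generalize qPochhammer x (r ^ 2) (n + 1) * qPochhammer (r ^ 2 / x) (r ^ 2) a = Θ
    have h1 : ((-1 : ℂ) ^ a) ≠ 0 := pow_ne_zero _ (by norm_num)
    field_simp
  rw [hL, key, Finset.mul_sum]
  refine Finset.sum_congr rfl fun j hj => ?_
  have hj' : j < a + (n + 1) := Finset.mem_range.1 hj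
  have hown := prod_range_erase_one_sub hr0 hj'
  have hrj : r ^ (j * (j + 1)) ≠ 0 := pow_ne_zero _ hr0
  rw [show ((a : ℤ) + ((j : ℤ) - a)).toNat = j by omega,
    show ((n : ℤ) - ((j : ℤ) - a)).toNat = a + (n + 1) - 1 - j by omega]
  have hown' : ∏ i ∈ (Finset.range (a + (n + 1))).erase j, (1 - (r ^ 2) ^ i / (r ^ 2) ^ j) =
      (-1) ^ j * (qPochhammer (r ^ 2) (r ^ 2) j *
        qPochhammer (r ^ 2) (r ^ 2) (a + (n + 1) - 1 - j)) / r ^ (j * (j + 1)) := by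
    rw [eq_div_iff hrj, mul_comm, hown]; ring
  rw [hown']
  have hscal : (-1 : ℂ) ^ a * ((r ^ 2) ^ a) ^ a * r ^ (j * (j + 1)) =
      (-1) ^ ((j : ℤ) - a) * r ^ (((j : ℤ) - a) * ((j : ℤ) - a + 1)) *
        (r ^ (a * (a + 1)) * ((r ^ 2) ^ j) ^ a * (-1) ^ j) := by
    have h1 : (-1 : ℂ) ^ ((j : ℤ) - a) * (-1) ^ j = (-1) ^ a := by
      rw [zpow_sub₀ (by norm_num), zpow_natCast, zpow_natCast, div_mul_eq_mul_div, ← mul_pow]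
      rcases neg_one_pow_eq_or ℂ a with h | h <;> norm_num [h]
    have h2 : ((r ^ 2) ^ a) ^ a * r ^ (j * (j + 1)) = r ^ (((j : ℤ) - a) * ((j : ℤ) - a + 1)) *
        (r ^ (a * (a + 1)) * ((r ^ 2) ^ j) ^ a) := by
      simp only [← pow_mul, ← pow_add]
      rw [← zpow_natCast, ← zpow_natCast, ← zpow_add₀ hr0]
      congr 1
      push_cast
      ring
    rw [← h1, mul_assoc, h2]
    ring
  have hD := hx ((j : ℤ) - a)
  generalize qPochhammer (r ^ 2) (r ^ 2) j *
    qPochhammer (r ^ 2) (r ^ 2) (a + (n + 1) - 1 - j) = Θ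
  generalize 1 - x * (r ^ 2) ^ ((j : ℤ) - a) = D at *
  have hs := pow_ne_zero j (show (-1 : ℂ) ≠ 0 by norm_num)
  have hpj : ((r ^ 2) ^ j) ^ a ≠ 0 := pow_ne_zero _ (pow_ne_zero _ hp0)
  rw [← div_eq_iff (mul_ne_zero (mul_ne_zero hra hpj) hs)] at hscal
  rw [← hscal]
  generalize ((r ^ 2) ^ j) ^ a = A at *
  generalize r ^ (a * (a + 1)) = B at *
  generalize ((r ^ 2) ^ a) ^ a = A' at *
  generalize r ^ (j * (j + 1)) = B' at *
  simp only [div_eq_mul_inv, mul_inv, inv_inv]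
  ring

/-- All monomials in the residue at node j are collected in terms of k = j - N. The deficit in m =
3N - 1 leaves one factor b and turns the linear exponent 3k into 5k. -/
lemma triple_scalar_identity {r b δ : ℂ} (hr : r ≠ 0) (hδ : δ ≠ 0) {N m : ℕ}
    (hm : m + 1 = 3 * N) (j : ℕ) :
    (-(b ^ 3 * δ)) ^ N * ((r ^ 2) ^ N) ^ m * (r ^ (j * (j + 1))) ^ 3 =
      b * ((-1) ^ ((j : ℤ) - N) *
        r ^ (3 * ((j : ℤ) - N) ^ 2 + 5 * ((j : ℤ) - N)) * δ ^ (-((j : ℤ) - N))) *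
        ((r ^ (N * (N + 1))) ^ 3 * ((b * (r ^ 2) ^ j) ^ m * ((-1) ^ j * δ ^ j))) := by
  have h1 : (-1 : ℂ) ^ ((j : ℤ) - N) * (-1) ^ j = (-1) ^ N := by
    rw [zpow_sub₀ (by norm_num), zpow_natCast, zpow_natCast, div_mul_eq_mul_div, ← mul_pow]
    rcases neg_one_pow_eq_or ℂ N with h | h <;> norm_num [h]
  have h2 : ((r ^ 2) ^ N) ^ m * (r ^ (j * (j + 1))) ^ 3 =
      r ^ (3 * ((j : ℤ) - N) ^ 2 + 5 * ((j : ℤ) - N)) *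
        ((r ^ (N * (N + 1))) ^ 3 * ((r ^ 2) ^ j) ^ m) := by
    simp only [← pow_mul, ← pow_add]
    rw [← zpow_natCast, ← zpow_natCast, ← zpow_add₀ hr]
    congr 1
    have : (m : ℤ) = 3 * N - 1 := by omega
    push_cast
    rw [this]
    ring
  have h3 : δ ^ (-((j : ℤ) - N)) * δ ^ j = δ ^ N := by
    rw [← zpow_natCast, ← zpow_natCast, ← zpow_add₀ hδ]
    congr 1
    ring
  have h4 : (b ^ 3) ^ N = b * b ^ m := by
    rw [← pow_mul, ← hm, pow_succ']
  rw [neg_pow, mul_pow, h4, ← h1, ← h3, mul_pow b]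
  calc _ = (-1 : ℂ) ^ ((j : ℤ) - N) * (-1) ^ j * (b * b ^ m * (δ ^ (-((j : ℤ) - N)) * δ ^ j)) *
        (((r ^ 2) ^ N) ^ m * (r ^ (j * (j + 1))) ^ 3) := by ring
    _ = _ := by rw [h2]; ring

/-- The denominators in the partial fraction expansion of a product of truncated theta functions. -/
def tripleDenom (r : ℂ) (b : Fin 3 → ℂ) (i : Fin 3) (N : ℕ) (k : ℤ) : ℂ :=
  qPochhammer (r ^ 2) (r ^ 2) ((N : ℤ) + k).toNat *
    qPochhammer (r ^ 2) (r ^ 2) ((N : ℤ) - 1 - k).toNat *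
    ∏ j ∈ Finset.univ.erase i, (qPochhammer (r ^ 2 / (b j / b i)) (r ^ 2) ((N : ℤ) + k).toNat *
      qPochhammer (b j / b i) (r ^ 2) ((N : ℤ) - k).toNat)

/-- The numerators in the partial fraction expansion of a product of three theta functions. -/
def tripleNumer (r : ℂ) (b : Fin 3 → ℂ) (i : Fin 3) (k : ℤ) : ℂ :=
  (-1) ^ k * r ^ (3 * k ^ 2 + 5 * k) * (∏ j ∈ Finset.univ.erase i, b j / b i) ^ (-k)

/-- Each parameter has 2N nodes, centred by evaluating at y = x / r^{2N}. Reflection produces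
x^{3N}, so the monomial of degree 3N - 1 leaves exactly the factor 1/x on the left. -/
lemma inv_prod_truncated_theta {r x : ℂ} (hr0 : r ≠ 0) (hr : ‖r‖ < 1) (hx0 : x ≠ 0)
    (b : Fin 3 → ℂ) (hb : ∀ i, b i ≠ 0)
    (hbb : ∀ i j, i ≠ j → ∀ k : ℤ, 1 - b j / b i * (r ^ 2) ^ k ≠ 0)
    (hx : ∀ i, ∀ k : ℤ, 1 - b i * x * (r ^ 2) ^ k ≠ 0) {N : ℕ} (hN : 0 < N) :
    (x * ∏ i, (qPochhammer (b i * x) (r ^ 2) N *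
      qPochhammer (r ^ 2 / (b i * x)) (r ^ 2) N))⁻¹ =
      ∑ i, b i * ∑' k : ℤ, if -(N : ℤ) ≤ k ∧ k < N then
        tripleNumer r b i k / tripleDenom r b i N k / (1 - b i * x * (r ^ 2) ^ k) else 0 := by
  have hp0 : r ^ 2 ≠ 0 := pow_ne_zero 2 hr0
  have hp := norm_sq_lt_one hr
  obtain ⟨m, hm⟩ : ∃ m, m + 1 = 3 * N := ⟨3 * N - 1, by omega⟩
  have hden : ∀ i, ∀ k : ℕ, 1 - x / (r ^ 2) ^ N * (b i * (r ^ 2) ^ k) =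
      1 - b i * x * (r ^ 2) ^ ((k : ℤ) - N) := by
    intro i k
    rw [zpow_sub₀ hp0, zpow_natCast, zpow_natCast]
    ring
  have hinj : ∀ i j (k l : ℕ), b i * (r ^ 2) ^ k = b j * (r ^ 2) ^ l → i = j ∧ k = l := by
    intro i j k l h
    by_cases hij : i = j
    · subst hij
      exact ⟨rfl, pow_injective_of_norm_lt_one hp0 hp (mul_left_cancel₀ (hb i) h)⟩
    · exfalso
      apply hbb i j hij ((l : ℤ) - k)
      rw [zpow_sub₀ hp0, zpow_natCast, zpow_natCast, div_mul_div_comm, ← h,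
        div_self (mul_ne_zero (hb i) (pow_ne_zero _ hp0)), sub_self]
  have key := pow_div_prod_qPochhammer hp0 b hb (N + N) hinj
    (m := m) (by simp; omega) (y := x / (r ^ 2) ^ N)
    (fun i k _ => by rw [hden]; exact hx i _)
  simp only [hden] at key
  have hrN : r ^ (N * (N + 1)) ≠ 0 := pow_ne_zero _ hr0
  set Θ := ∏ i, (qPochhammer (b i * x) (r ^ 2) N *
      qPochhammer (r ^ 2 / (b i * x)) (r ^ 2) N) with hΘ
  have hA : ∏ i, qPochhammer (b i * (x / (r ^ 2) ^ N)) (r ^ 2) (N + N) =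
      (-(x ^ 3 * ∏ i, b i)) ^ N * Θ / (r ^ (N * (N + 1))) ^ 3 := by
    have h : ∀ i, qPochhammer (b i * (x / (r ^ 2) ^ N)) (r ^ 2) (N + N) =
        (-(b i * x)) ^ N * (qPochhammer (b i * x) (r ^ 2) N *
          qPochhammer (r ^ 2 / (b i * x)) (r ^ 2) N) / r ^ (N * (N + 1)) := by
      intro i
      rw [eq_div_iff hrN, mul_comm, ← mul_div_assoc,
        qPochhammer_shift hr0 (mul_ne_zero (hb i) hx0) N N]
      ring
    rw [Finset.prod_congr rfl fun i _ => h i, Finset.prod_div_distrib, Finset.prod_mul_distrib,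
      Finset.prod_pow]
    simp only [hΘ, Finset.prod_const, Finset.card_univ, Fintype.card_fin, Fin.prod_univ_three]
    ring
  have hW : ∏ i, b i ≠ 0 := Finset.prod_ne_zero_iff.2 fun i _ => hb i
  have hL : (x * Θ)⁻¹ = (-∏ i, b i) ^ N * ((r ^ 2) ^ N) ^ m / (r ^ (N * (N + 1))) ^ 3 *
      ((x / (r ^ 2) ^ N) ^ m / ∏ i, qPochhammer (b i * (x / (r ^ 2) ^ N)) (r ^ 2) (N + N)) := by
    rw [hA, div_pow, show -(x ^ 3 * ∏ i, b i) = x ^ 3 * -∏ i, b i by ring, mul_pow, ← pow_mul x,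
      ← hm, pow_succ x m]
    have h1 := pow_ne_zero N (neg_ne_zero.2 hW)
    generalize (-∏ i, b i) ^ N = W at *
    have h2 : ((r ^ 2) ^ N) ^ m ≠ 0 := pow_ne_zero _ (pow_ne_zero _ hp0)
    field_simp
  rw [hL, key, Finset.mul_sum]
  refine Finset.sum_congr rfl fun i _ => ?_
  rw [← sum_range_eq_tsum_int (fun k => tripleNumer r b i k / tripleDenom r b i N k /
    (1 - b i * x * (r ^ 2) ^ k)), Finset.mul_sum, Finset.mul_sum]
  refine Finset.sum_congr rfl fun j hj => ?_
  have hj' : j < N + N := Finset.mem_range.1 hj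
  have hrj : r ^ (j * (j + 1)) ≠ 0 := pow_ne_zero _ hr0
  set δ := ∏ j ∈ Finset.univ.erase i, b j / b i with hδ
  have hδ0 : δ ≠ 0 := Finset.prod_ne_zero_iff.2 fun l _ => div_ne_zero (hb l) (hb i)
  have hcard : (Finset.univ.erase i).card = 2 := by
    rw [Finset.card_erase_of_mem (Finset.mem_univ i)]; simp
  have hWδ : ∏ l, b l = b i ^ 3 * δ := by
    rw [hδ, Finset.prod_div_distrib, Finset.prod_const, hcard,
      ← Finset.mul_prod_erase Finset.univ b (Finset.mem_univ i)]
    have := hb i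
    field_simp
  have hown : (∏ l ∈ (Finset.range (N + N)).erase j, (1 - (r ^ 2) ^ l / (r ^ 2) ^ j)) *
      ∏ l ∈ Finset.univ.erase i, qPochhammer (b l / b i / (r ^ 2) ^ j) (r ^ 2) (N + N) =
      ((-1) ^ j * δ ^ j) * tripleDenom r b i N ((j : ℤ) - N) / (r ^ (j * (j + 1))) ^ 3 := by
    have h1 := prod_range_erase_one_sub hr0 hj'
    have h2 : ∀ l, qPochhammer (b l / b i / (r ^ 2) ^ j) (r ^ 2) (N + N) =
        (-1) ^ j * (b l / b i) ^ j * (qPochhammer (r ^ 2 / (b l / b i)) (r ^ 2) j *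
          qPochhammer (b l / b i) (r ^ 2) (N + N - j)) / r ^ (j * (j + 1)) := by
      intro l
      rw [eq_div_iff hrj, mul_comm]
      have := qPochhammer_shift hr0 (div_ne_zero (hb l) (hb i)) j (N + N - j)
      rw [show j + (N + N - j) = N + N by omega] at this
      rw [this, ← neg_pow]
      ring
    rw [Finset.prod_congr rfl fun l _ => h2 l, Finset.prod_div_distrib, Finset.prod_mul_distrib,
      Finset.prod_mul_distrib, Finset.prod_const, Finset.prod_const, hcard, Finset.prod_pow,
      eq_div_iff (pow_ne_zero _ hrj), tripleDenom,
      show ((N : ℤ) + ((j : ℤ) - N)).toNat = j by omega,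
      show ((N : ℤ) - 1 - ((j : ℤ) - N)).toNat = N + N - 1 - j by omega,
      show ((N : ℤ) - ((j : ℤ) - N)).toNat = N + N - j by omega]
    have h3 : ((-1 : ℂ) ^ j) ^ 2 = 1 := by rw [← pow_mul, mul_comm, pow_mul]; norm_num
    rw [h3, one_mul, ← hδ]
    generalize (∏ l ∈ (Finset.range (N + N)).erase j, (1 - (r ^ 2) ^ l / (r ^ 2) ^ j)) = O at *
    generalize (∏ l ∈ Finset.univ.erase i, (qPochhammer (r ^ 2 / (b l / b i)) (r ^ 2) j *
          qPochhammer (b l / b i) (r ^ 2) (N + N - j))) = Q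
    calc _ = (r ^ (j * (j + 1)) * O) * (δ ^ j * Q) := by field_simp
      _ = _ := by rw [h1]; ring
  rw [hown, hWδ]
  have hscal := triple_scalar_identity (b := b i) hr0 hδ0 hm j
  rw [← div_eq_iff] at hscal
  · have e : ∀ c D E : ℂ, b i * (c / D / E) = (b i * c) / D / E := fun c D E => by ring
    rw [tripleNumer, ← hδ, e, ← hscal]
    simp only [div_eq_mul_inv, mul_inv, inv_inv]
    ring
  · have h1 : (-1 : ℂ) ^ j ≠ 0 := pow_ne_zero _ (by norm_num)
    exact mul_ne_zero (pow_ne_zero _ hrN) (mul_ne_zero (pow_ne_zero _ (mul_ne_zero (hb i)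
      (pow_ne_zero _ hp0))) (mul_ne_zero h1 (pow_ne_zero _ hδ0)))

/-- The theta product `(x; q)_∞ (q/x; q)_∞`. -/
def thetaProd (x q : ℂ) : ℂ := qPochhammerInf x q * qPochhammerInf (q / x) q

lemma one_sub_pow_mul_ne_zero {q x : ℂ} (hx : ∀ k : ℤ, 1 - x * q ^ k ≠ 0) (i : ℕ) :
    1 - q ^ i * x ≠ 0 := by
  have := hx i
  rwa [zpow_natCast, mul_comm] at this

lemma one_sub_pow_mul_div_ne_zero {q x : ℂ} (hx0 : x ≠ 0)
    (hx : ∀ k : ℤ, 1 - x * q ^ k ≠ 0) (i : ℕ) : 1 - q ^ i * (q / x) ≠ 0 := by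
  intro h
  apply hx (-((i + 1 : ℕ) : ℤ))
  have h1 : q ^ (i + 1) = x := by
    rw [sub_eq_zero] at h
    field_simp at h
    rw [pow_succ, ← h]
  rw [zpow_neg, zpow_natCast, h1, mul_inv_cancel₀ hx0, sub_self]

lemma thetaProd_ne_zero {q x : ℂ} (hq : ‖q‖ < 1) (hx0 : x ≠ 0)
    (hx : ∀ k : ℤ, 1 - x * q ^ k ≠ 0) : thetaProd x q ≠ 0 :=
  mul_ne_zero (qPochhammerInf_ne_zero hq (one_sub_pow_mul_ne_zero hx))
    (qPochhammerInf_ne_zero hq (one_sub_pow_mul_div_ne_zero hx0 hx))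

lemma one_sub_pow_mul_self_ne_zero {q : ℂ} (hq : ‖q‖ < 1) (i : ℕ) : 1 - q ^ i * q ≠ 0 :=
  one_sub_pow_mul_ne_zero_of_norm_lt hq hq i

/-- The bound is uniform in both N and k because every factor is a finite Pochhammer symbol whose
inverse is bounded over all lengths. -/
lemma exists_norm_inv_tripleDenom_le {r : ℂ} (hr0 : r ≠ 0) (hr : ‖r‖ < 1)
    (b : Fin 3 → ℂ) (hb : ∀ i, b i ≠ 0)
    (hbb : ∀ i j, i ≠ j → ∀ k : ℤ, 1 - b j / b i * (r ^ 2) ^ k ≠ 0) (i : Fin 3) :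
    ∃ C : ℝ, 0 < C ∧ ∀ N k, ‖(tripleDenom r b i N k)⁻¹‖ ≤ C := by
  have hp0 : r ^ 2 ≠ 0 := pow_ne_zero 2 hr0
  have hp := norm_sq_lt_one hr
  obtain ⟨A, hA0, hA⟩ := exists_norm_inv_qPochhammer_le hp (one_sub_pow_mul_self_ne_zero hp)
  have h : ∀ j, ∃ C : ℝ, 0 < C ∧ (i ≠ j → ∀ n m,
      ‖(qPochhammer (r ^ 2 / (b j / b i)) (r ^ 2) n * qPochhammer (b j / b i) (r ^ 2) m)⁻¹‖
        ≤ C) := by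
    intro j
    by_cases hij : i = j
    · exact ⟨1, one_pos, fun h => absurd hij h⟩
    have h1 := hbb i j hij
    have h2 := div_ne_zero (hb j) (hb i)
    obtain ⟨B, hB0, hB⟩ := exists_norm_inv_qPochhammer_le hp (one_sub_pow_mul_ne_zero h1)
    obtain ⟨D, hD0, hD⟩ :=
      exists_norm_inv_qPochhammer_le hp (one_sub_pow_mul_div_ne_zero h2 h1)
    refine ⟨D * B, by positivity, fun _ n m => ?_⟩
    rw [mul_inv, norm_mul]
    exact mul_le_mul (hD n) (hB m) (norm_nonneg _) hD0.le
  choose C hC0 hC using h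
  refine ⟨A * A * ∏ j ∈ Finset.univ.erase i, C j,
    mul_pos (mul_pos hA0 hA0) (Finset.prod_pos fun j _ => hC0 j), fun N k => ?_⟩
  rw [tripleDenom, mul_inv, mul_inv, norm_mul, norm_mul, ← Finset.prod_inv_distrib, norm_prod]
  refine mul_le_mul (mul_le_mul (hA _) (hA _) (norm_nonneg _) hA0.le)
    (Finset.prod_le_prod (fun _ _ => norm_nonneg _) fun j hj => hC j ?_ _ _)
    (Finset.prod_nonneg fun _ _ => norm_nonneg _) (by positivity)
  exact (Finset.ne_of_mem_erase hj).symm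

/-- The limit of `tripleDenom` as the truncation parameter tends to infinity. -/
def tripleDenomInf (r : ℂ) (b : Fin 3 → ℂ) (i : Fin 3) : ℂ :=
  qPochhammerInf (r ^ 2) (r ^ 2) ^ 2 * ∏ j ∈ Finset.univ.erase i, thetaProd (b j / b i) (r ^ 2)

lemma tendsto_tripleDenom {r : ℂ} (hr : ‖r‖ < 1) (b : Fin 3 → ℂ) (i : Fin 3) (k : ℤ) :
    Filter.Tendsto (fun N => tripleDenom r b i N k) Filter.atTop
      (nhds (tripleDenomInf r b i)) := by
  have hp := norm_sq_lt_one hr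
  have h1 := tendsto_toNat_add k
  have h2 := tendsto_toNat_add (-k)
  have h3 : Filter.Tendsto (fun N : ℕ => ((N : ℤ) - 1 - k).toNat) Filter.atTop Filter.atTop := by
    refine (tendsto_toNat_add (-1 - k)).congr fun N => ?_
    congr 1; ring
  simp only [← sub_eq_add_neg] at h2
  rw [tripleDenomInf, pow_two]
  refine Filter.Tendsto.mul (((tendsto_qPochhammer hp _).comp h1).mul
    ((tendsto_qPochhammer hp _).comp h3)) (tendsto_finsetProd _ fun j _ => ?_)
  rw [thetaProd, mul_comm]
  exact ((tendsto_qPochhammer hp _).comp h1).mul ((tendsto_qPochhammer hp _).comp h2)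

lemma summable_norm_tripleNumer {r : ℂ} (hr0 : r ≠ 0) (hr : ‖r‖ < 1) (b : Fin 3 → ℂ)
    (hb : ∀ i, b i ≠ 0) (i : Fin 3) : Summable fun k => ‖tripleNumer r b i k‖ := by
  have hδ : ∏ j ∈ Finset.univ.erase i, b j / b i ≠ 0 :=
    Finset.prod_ne_zero_iff.2 fun l _ => div_ne_zero (hb l) (hb i)
  refine (summable_norm_zpow_quadratic hr0 hr (inv_ne_zero hδ) (a := 3) (by norm_num) 5).congr
    fun k => ?_
  rw [tripleNumer, norm_mul, norm_mul, norm_mul, inv_zpow', norm_zpow (-1 : ℂ)]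
  simp

/-- Partial fraction expansion of the reciprocal of a product of three theta products. -/
theorem inv_prod_thetaProd {r x : ℂ} (hr0 : r ≠ 0) (hr : ‖r‖ < 1) (hx0 : x ≠ 0)
    (b : Fin 3 → ℂ) (hb : ∀ i, b i ≠ 0)
    (hbb : ∀ i j, i ≠ j → ∀ k : ℤ, 1 - b j / b i * (r ^ 2) ^ k ≠ 0)
    (hx : ∀ i, ∀ k : ℤ, 1 - b i * x * (r ^ 2) ^ k ≠ 0) :
    (x * ∏ i, thetaProd (b i * x) (r ^ 2))⁻¹ =
      ∑ i, b i * ∑' k : ℤ,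
        tripleNumer r b i k / tripleDenomInf r b i / (1 - b i * x * (r ^ 2) ^ k) := by
  have hp0 : r ^ 2 ≠ 0 := pow_ne_zero 2 hr0
  have hp := norm_sq_lt_one hr
  have hL : Filter.Tendsto (fun N => (x * ∏ i, (qPochhammer (b i * x) (r ^ 2) N *
      qPochhammer (r ^ 2 / (b i * x)) (r ^ 2) N))⁻¹) Filter.atTop
      (nhds (x * ∏ i, thetaProd (b i * x) (r ^ 2))⁻¹) := by
    refine Filter.Tendsto.inv₀ (Filter.Tendsto.const_mul _ (tendsto_finsetProd _ fun i _ =>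
      (tendsto_qPochhammer hp _).mul (tendsto_qPochhammer hp _))) ?_
    exact mul_ne_zero hx0 (Finset.prod_ne_zero_iff.2 fun i _ =>
      thetaProd_ne_zero hp (mul_ne_zero (hb i) hx0) (hx i))
  have hR : Filter.Tendsto (fun N : ℕ => ∑ i, b i * ∑' k : ℤ, if -(N : ℤ) ≤ k ∧ k < N then
        tripleNumer r b i k / tripleDenom r b i N k / (1 - b i * x * (r ^ 2) ^ k) else 0)
      Filter.atTop (nhds (∑ i, b i * ∑' k : ℤ,
        tripleNumer r b i k / tripleDenomInf r b i / (1 - b i * x * (r ^ 2) ^ k))) := by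
    refine tendsto_finsetSum _ fun i _ => Filter.Tendsto.const_mul _ ?_
    obtain ⟨C, hC0, hC⟩ := exists_norm_inv_tripleDenom_le hr0 hr b hb hbb i
    obtain ⟨D, hD0, hD⟩ := exists_norm_inv_one_sub_zpow_le hp0 hp (b i * x)
    have hne : tripleDenomInf r b i ≠ 0 := by
      refine mul_ne_zero (pow_ne_zero _ (qPochhammerInf_ne_zero hp
        (one_sub_pow_mul_self_ne_zero hp))) (Finset.prod_ne_zero_iff.2 fun j hj => ?_)
      exact thetaProd_ne_zero hp (div_ne_zero (hb j) (hb i))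
        (hbb i j (Finset.ne_of_mem_erase hj).symm)
    refine tendsto_tsum_of_dominated_convergence
      (((summable_norm_tripleNumer hr0 hr b hb i).mul_right C).mul_right D) (fun k => ?_)
      (Filter.Eventually.of_forall fun N k => ?_)
    · have h1 := (((tendsto_tripleDenom hr b i k).inv₀ hne).const_mul
        (tripleNumer r b i k)).div_const (1 - b i * x * (r ^ 2) ^ k)
      refine h1.congr' ?_
      filter_upwards [Filter.eventually_ge_atTop (k.natAbs + 1)] with N hN
      rw [if_pos (by omega), div_eq_mul_inv (tripleNumer r b i k)]
    · split_ifs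
      · rw [div_eq_mul_inv, div_eq_mul_inv, norm_mul, norm_mul]
        exact mul_le_mul (mul_le_mul_of_nonneg_left (hC N k) (norm_nonneg _)) (hD k)
          (norm_nonneg _) (by positivity)
      · rw [norm_zero]; positivity
  refine tendsto_nhds_unique hL (hR.congr' ?_)
  filter_upwards [Filter.eventually_gt_atTop 0] with N hN
  exact (inv_prod_truncated_theta hr0 hr hx0 b hb hbb hx hN).symm

/-! ### The Durfee rectangle identity and the sum over n -/

/-- The terms of the Durfee rectangle series. -/
def durfeeTerm (q : ℂ) (c m : ℕ) : ℂ :=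
  q ^ (m ^ 2 + c * m) / (qPochhammer q q m * qPochhammer q q (m + c))

lemma exists_norm_durfeeTerm_le {q : ℂ} (hq : ‖q‖ < 1) :
    ∃ A : ℝ, 0 < A ∧ ∀ c m, ‖durfeeTerm q c m‖ ≤ A * ‖q‖ ^ m := by
  obtain ⟨A, hA0, hA⟩ := exists_norm_inv_qPochhammer_le hq (one_sub_pow_mul_self_ne_zero hq)
  refine ⟨A * A, by positivity, fun c m => ?_⟩
  rw [durfeeTerm, div_eq_mul_inv, mul_inv, norm_mul, norm_mul, norm_pow, mul_comm]
  refine mul_le_mul (mul_le_mul (hA _) (hA _) (norm_nonneg _) hA0.le)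
    (pow_le_pow_of_le_one (norm_nonneg _) hq.le ?_) (by positivity) (by positivity)
  nlinarith [Nat.zero_le (c * m), Nat.le_self_pow two_ne_zero m]

lemma summable_durfeeTerm {q : ℂ} (hq : ‖q‖ < 1) (c : ℕ) : Summable (durfeeTerm q c) := by
  obtain ⟨A, -, hA⟩ := exists_norm_durfeeTerm_le hq
  exact Summable.of_norm_bounded
    ((summable_geometric_of_lt_one (norm_nonneg q) hq).mul_left A) (hA c)

/-- Termwise, D_c - (1 - q^{c+1}) D_{c+1} carries a factor 1 - q^m. It kills m = 0 and cancels the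
last factor of (q; q)_m, so shifting m by one gives q^{c+1} D_{c+2}. -/
lemma durfee_difference {q : ℂ} (hq : ‖q‖ < 1) (c : ℕ) :
    (∑' m, durfeeTerm q c m) - ∑' m, durfeeTerm q (c + 1) m =
      -q ^ (c + 1) * ((∑' m, durfeeTerm q (c + 1) m) - ∑' m, durfeeTerm q (c + 2) m) := by
  have hne : ∀ n, qPochhammer q q n ≠ 0 :=
    qPochhammer_ne_zero (one_sub_pow_mul_self_ne_zero hq)
  set s : ℕ → ℂ := fun m => durfeeTerm q c m - durfeeTerm q (c + 1) m +
    q ^ (c + 1) * durfeeTerm q (c + 1) m with hs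
  have hs' : ∀ m, s m = q ^ (m ^ 2 + c * m) * (1 - q ^ m) /
      (qPochhammer q q m * qPochhammer q q (m + c + 1)) := by
    intro m
    have h1 := hne m
    have h2 := hne (m + c + 1)
    have h3 := hne (m + c)
    rw [qPochhammer_succ] at h2
    have h4 := right_ne_zero_of_mul h2
    simp only [hs, durfeeTerm, ← add_assoc, qPochhammer_succ]
    field_simp
    ring
  have hsum1 := summable_durfeeTerm hq c
  have hsum2 := summable_durfeeTerm hq (c + 1)
  have hsum3 := summable_durfeeTerm hq (c + 2)
  have hsum : Summable s := (hsum1.sub hsum2).add (hsum2.mul_left _)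
  have hsucc : ∀ m, s (m + 1) = q ^ (c + 1) * durfeeTerm q (c + 2) m := by
    intro m
    have h1 := hne (m + 1)
    have h2 := hne (m + (c + 2))
    have h3 := hne m
    rw [hs', durfeeTerm, show m + 1 + c + 1 = m + (c + 2) by ring]
    rw [qPochhammer_succ] at h1 ⊢
    have h4 := right_ne_zero_of_mul h1
    rw [← pow_succ] at h4 ⊢
    field_simp
    ring
  have h0 : s 0 = 0 := by simp [hs']
  have e1 : ∑' m, s m = (∑' m, durfeeTerm q c m) - (∑' m, durfeeTerm q (c + 1) m) +
      q ^ (c + 1) * ∑' m, durfeeTerm q (c + 1) m := by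
    rw [hs, (hsum1.sub hsum2).tsum_add (hsum2.mul_left _), hsum1.tsum_sub hsum2, tsum_mul_left]
  have e2 : ∑' m, s m = q ^ (c + 1) * ∑' m, durfeeTerm q (c + 2) m := by
    rw [hsum.tsum_eq_zero_add, h0, zero_add, tsum_congr hsucc, tsum_mul_left]
  linear_combination e2 - e1

/-- Consecutive differences are bounded uniformly in c, and by `durfee_difference` each is at most
|q| times the next in norm. Iterating forces them to vanish. -/
lemma tsum_durfeeTerm_succ {q : ℂ} (hq : ‖q‖ < 1) (c : ℕ) :
    ∑' m, durfeeTerm q (c + 1) m = ∑' m, durfeeTerm q c m := by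
  obtain ⟨A, hA0, hA⟩ := exists_norm_durfeeTerm_le hq
  have hg := summable_geometric_of_lt_one (norm_nonneg q) hq
  set K := A * ∑' m : ℕ, ‖q‖ ^ m
  have hK : ∀ c, ‖∑' m, durfeeTerm q c m‖ ≤ K := fun c =>
    tsum_of_norm_bounded (hg.hasSum.mul_left A) (hA c)
  set d : ℕ → ℂ := fun c => (∑' m, durfeeTerm q c m) - ∑' m, durfeeTerm q (c + 1) m with hd
  have hdK : ∀ c, ‖d c‖ ≤ K + K := fun c =>
    (norm_sub_le _ _).trans (add_le_add (hK _) (hK _))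
  have hstep : ∀ n c, ‖d c‖ ≤ ‖q‖ ^ n * ‖d (c + n)‖ := by
    intro n
    induction n with
    | zero => intro c; simp
    | succ n ih =>
      intro c
      refine (ih c).trans ?_
      have h1 : ‖d (c + n)‖ ≤ ‖q‖ * ‖d (c + (n + 1))‖ := by
        simp only [hd]
        rw [durfee_difference hq (c + n), norm_mul, norm_neg, norm_pow]
        refine mul_le_mul_of_nonneg_right ?_ (norm_nonneg _)
        exact pow_le_of_le_one (norm_nonneg _) hq.le (by omega)
      calc _ ≤ ‖q‖ ^ n * (‖q‖ * ‖d (c + (n + 1))‖) :=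
            mul_le_mul_of_nonneg_left h1 (by positivity)
        _ = _ := by ring
  have hlim : Filter.Tendsto (fun n : ℕ => ‖q‖ ^ n * (K + K)) Filter.atTop (nhds 0) := by
    simpa using (tendsto_pow_atTop_nhds_zero_of_lt_one (norm_nonneg q) hq).mul_const (K + K)
  have h0 : ‖d c‖ ≤ 0 := ge_of_tendsto' hlim fun n =>
    (hstep n c).trans (mul_le_mul_of_nonneg_left (hdK _) (by positivity))
  exact (sub_eq_zero.1 (norm_le_zero_iff.1 h0)).symm

/-- The Durfee rectangle identity. -/
theorem tsum_durfeeTerm {q : ℂ} (hq : ‖q‖ < 1) (c : ℕ) :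
    ∑' m, durfeeTerm q c m = (qPochhammerInf q q)⁻¹ := by
  have hconst : ∀ n, ∑' m, durfeeTerm q (n + c) m = ∑' m, durfeeTerm q c m := by
    intro n
    induction n with
    | zero => simp
    | succ n ih => rw [← ih, ← tsum_durfeeTerm_succ hq (n + c), show n + 1 + c = n + c + 1 by ring]
  obtain ⟨A, hA0, hA⟩ := exists_norm_durfeeTerm_le hq
  have hg := summable_geometric_of_lt_one (norm_nonneg q) hq
  have hne := qPochhammerInf_ne_zero hq (one_sub_pow_mul_self_ne_zero hq)
  -- The sum does not depend on c, so it may be computed as c → ∞, where only m = 0 survives.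
  have hlim : Filter.Tendsto (fun n => ∑' m, durfeeTerm q (n + c) m) Filter.atTop
      (nhds (∑' m, if m = 0 then (qPochhammerInf q q)⁻¹ else 0)) := by
    refine tendsto_tsum_of_dominated_convergence (hg.mul_left A) (fun m => ?_)
      (Filter.Eventually.of_forall fun n m => hA _ m)
    have h1 : Filter.Tendsto (fun n => qPochhammer q q (m + (n + c))) Filter.atTop
        (nhds (qPochhammerInf q q)) := by
      refine (tendsto_qPochhammer hq q).comp ?_
      exact Filter.tendsto_atTop_mono (fun n => show n ≤ m + (n + c) by omega) Filter.tendsto_id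
    by_cases hm : m = 0
    · subst hm
      simpa [durfeeTerm, qPochhammer_zero] using h1.inv₀ hne
    · rw [if_neg hm]
      have h2 : Filter.Tendsto (fun n : ℕ => q ^ (m ^ 2 + c * m) * (q ^ m) ^ n) Filter.atTop
          (nhds (q ^ (m ^ 2 + c * m) * 0)) := by
        refine (tendsto_pow_atTop_nhds_zero_of_norm_lt_one ?_).const_mul _
        rw [norm_pow]
        exact pow_lt_one₀ (norm_nonneg _) hq hm
      have h3 := h2.div (h1.const_mul (qPochhammer q q m)) (mul_ne_zero
        (qPochhammer_ne_zero (one_sub_pow_mul_self_ne_zero hq) m) hne)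
      rw [mul_zero, zero_div] at h3
      refine h3.congr fun n => ?_
      rw [durfeeTerm, Pi.div_apply]
      congr 1
      ring
  rw [tsum_ite_eq] at hlim
  exact tendsto_nhds_unique (tendsto_const_nhds.congr fun n => (hconst n).symm) hlim

/-- With n = m + l one has n(n + e) = m² + (2l + e)m + l(l + e), which is the Durfee series for c =
2l + e. -/
lemma tsum_shifted_durfee {q : ℂ} (hq : ‖q‖ < 1) (l e : ℕ) :
    ∑' n : ℕ, (if l ≤ n then
      q ^ (n * (n + e)) / (qPochhammer q q (n - l) * qPochhammer q q (n + l + e)) else 0) =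
      q ^ (l * (l + e)) * (qPochhammerInf q q)⁻¹ := by
  rw [← tsum_durfeeTerm hq (2 * l + e), ← tsum_mul_left,
    ← Function.Injective.tsum_eq (add_left_injective l)]
  · refine tsum_congr fun m => ?_
    simp only [le_add_iff_nonneg_left, zero_le, if_true, Nat.add_sub_cancel, durfeeTerm]
    rw [show m + l + l + e = m + (2 * l + e) by ring, ← mul_div_assoc, ← pow_add]
    congr 2
    ring
  · intro n hn
    by_cases h : l ≤ n
    · exact ⟨n - l, Nat.sub_add_cancel h⟩
    · simp [h] at hn

/-- The summand and k(k + e) are invariant under k ↦ -k - e, which reduces to a natural number l.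
This is a limiting case of Bailey's lemma. -/
lemma tsum_bailey_weight {r : ℂ} (hr : ‖r‖ < 1) {e : ℕ} (he : e ≤ 1)
    (k : ℤ) :
    ∑' n : ℕ, (if -((n + e : ℕ) : ℤ) ≤ k ∧ k < (n + 1 : ℕ) then
      (r ^ 2) ^ (n * (n + e)) / (qPochhammer (r ^ 2) (r ^ 2) ((n + e : ℕ) + k).toNat *
          qPochhammer (r ^ 2) (r ^ 2) ((n : ℤ) - k).toNat) else 0) =
      r ^ (2 * (k * (k + e))) * (qPochhammerInf (r ^ 2) (r ^ 2))⁻¹ := by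
  have hp := norm_sq_lt_one hr
  have hexp : ∀ l : ℕ, (l : ℤ) * (l + e) = k * (k + e) →
      r ^ (2 * (k * (k + e))) = (r ^ 2) ^ (l * (l + e)) := by
    intro l hl
    rw [← hl, ← pow_mul, ← zpow_natCast]
    push_cast
    rfl
  by_cases hk : 0 ≤ k
  · obtain ⟨l, rfl⟩ := Int.eq_ofNat_of_zero_le hk
    rw [hexp l rfl, ← tsum_shifted_durfee hp]
    refine tsum_congr fun n => ?_
    by_cases h : l ≤ n
    · rw [if_pos (by omega), if_pos h, mul_comm (qPochhammer _ _ _)]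
      congr 3 <;> omega
    · rw [if_neg (by omega), if_neg h]
  · obtain ⟨l, hl⟩ := Int.eq_ofNat_of_zero_le (show 0 ≤ -k - e by omega)
    have hl' : k = -l - e := by omega
    rw [hexp l (by rw [hl']; ring), ← tsum_shifted_durfee hp]
    refine tsum_congr fun n => ?_
    by_cases h : l ≤ n
    · rw [if_pos (by omega), if_pos h]
      congr 3 <;> omega
    · rw [if_neg (by omega), if_neg h]

/-! ### Appell–Lerch series of the mock theta functions -/

/-- Expansion of a universal mock theta function as an Appell–Lerch series. -/
theorem tsum_universal_mock_theta {r x : ℂ} (hr0 : r ≠ 0) (hr : ‖r‖ < 1) (hx0 : x ≠ 0)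
    (hx : ∀ k : ℤ, 1 - x * (r ^ 2) ^ k ≠ 0) {e : ℕ} (he : e ≤ 1) :
    ∑' n : ℕ, (r ^ 2) ^ (n * (n + e)) /
        (qPochhammer x (r ^ 2) (n + 1) * qPochhammer (r ^ 2 / x) (r ^ 2) (n + e)) =
      (∑' k : ℤ, (-1) ^ k * r ^ (k * (k + 1) + 2 * (k * (k + e))) / (1 - x * (r ^ 2) ^ k)) /
        qPochhammerInf (r ^ 2) (r ^ 2) := by
  have hp0 : r ^ 2 ≠ 0 := pow_ne_zero 2 hr0
  have hp := norm_sq_lt_one hr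
  set w : ℕ → ℤ → ℂ := fun n k => if -((n + e : ℕ) : ℤ) ≤ k ∧ k < (n + 1 : ℕ) then
      (r ^ 2) ^ (n * (n + e)) / (qPochhammer (r ^ 2) (r ^ 2) ((n + e : ℕ) + k).toNat *
          qPochhammer (r ^ 2) (r ^ 2) ((n : ℤ) - k).toNat) else 0 with hw
  set F : ℕ → ℤ → ℂ := fun n k =>
    ((-1) ^ k * r ^ (k * (k + 1)) / (1 - x * (r ^ 2) ^ k)) * w n k with hF
  have h1 : ∀ n, (r ^ 2) ^ (n * (n + e)) /
      (qPochhammer x (r ^ 2) (n + 1) * qPochhammer (r ^ 2 / x) (r ^ 2) (n + e)) =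
      ∑' k, F n k := by
    intro n
    rw [div_eq_mul_inv, inv_qPochhammer_mul_qPochhammer hr0 hr hx0 hx n e, ← tsum_mul_left]
    refine tsum_congr fun k => ?_
    simp only [hF, hw]
    split_ifs
    · simp only [div_eq_mul_inv]; ring
    · simp
  have hsum : Summable (Function.uncurry F) := by
    obtain ⟨A, hA0, hA⟩ := exists_norm_inv_qPochhammer_le hp (one_sub_pow_mul_self_ne_zero hp)
    obtain ⟨D, hD0, hD⟩ := exists_norm_inv_one_sub_zpow_le hp0 hp x
    have hg := summable_geometric_of_lt_one (norm_nonneg r) hr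
    have hz := summable_norm_zpow_quadratic hr0 hr one_ne_zero (a := 1) one_pos e
    refine Summable.of_norm_bounded (((hg.mul_of_nonneg hz (fun _ => by positivity)
      (fun _ => norm_nonneg _)).mul_left (D * (A * A)))) ?_
    rintro ⟨n, k⟩
    simp only [Function.uncurry, hF, hw, one_zpow, mul_one]
    split_ifs with h
    · have e1 : ‖r ^ (k * (k + 1))‖ ≤ 1 := by
        have hk : 0 ≤ k * (k + 1) := by
          rcases le_or_gt 0 k with h | h
          · positivity
          · nlinarith
        obtain ⟨t, ht⟩ := Int.eq_ofNat_of_zero_le hk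
        rw [ht, zpow_natCast, norm_pow]
        exact pow_le_one₀ (norm_nonneg _) hr.le
      -- The exponent 2n(n + e) is split in half: one half gives decay in n, the other decay in k,
      -- since (n - k)(n + k + e) ≥ 0 on the support.
      have e2 : ‖(r ^ 2) ^ (n * (n + e))‖ ≤ ‖r‖ ^ n * ‖r ^ ((1 : ℕ) * k ^ 2 + e * k)‖ := by
        have hk : 0 ≤ (1 : ℕ) * k ^ 2 + e * k := by
          have : (e : ℤ) = 0 ∨ (e : ℤ) = 1 := by omega
          rcases this with h | h <;> rw [h]
          · norm_num; positivity
          · rcases le_or_gt 0 k with h | h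
            · positivity
            · push_cast; nlinarith
        have hle : (1 : ℕ) * k ^ 2 + e * k ≤ (n * (n + e) : ℕ) := by
          push_cast at h ⊢
          nlinarith [mul_nonneg (show (0 : ℤ) ≤ n - k by omega)
            (show (0 : ℤ) ≤ n + k + e by omega)]
        obtain ⟨t, ht⟩ := Int.eq_ofNat_of_zero_le hk
        rw [ht] at hle ⊢
        rw [zpow_natCast, norm_pow, norm_pow, norm_pow, ← pow_add, ← pow_mul]
        refine pow_le_pow_of_le_one (norm_nonneg _) hr.le ?_
        have h4 : t ≤ n * (n + e) := by exact_mod_cast hle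
        have h5 : n ≤ n * (n + e) := by nlinarith [Nat.le_self_pow two_ne_zero n]
        omega
      rw [norm_mul, div_eq_mul_inv, norm_mul, norm_mul, norm_zpow, norm_neg, norm_one, one_zpow,
        one_mul, div_eq_mul_inv, norm_mul, mul_inv, norm_mul]
      have e3 := mul_le_mul (hA ((n + e : ℕ) + k).toNat) (hA ((n : ℤ) - k).toNat)
        (norm_nonneg _) hA0.le
      have e4 := mul_le_mul e1 (hD k) (norm_nonneg _) zero_le_one
      rw [one_mul] at e4
      calc _ ≤ D * ((‖r‖ ^ n * ‖r ^ ((1 : ℕ) * k ^ 2 + e * k)‖) * (A * A)) :=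
            mul_le_mul e4 (mul_le_mul e2 e3 (by positivity) (by positivity)) (by positivity)
              hD0.le
        _ = _ := by ring
    · rw [mul_zero, norm_zero]; positivity
  rw [tsum_congr h1, ← hsum.tsum_comm, div_eq_mul_inv, ← tsum_mul_right]
  refine tsum_congr fun k => ?_
  simp only [hF]
  rw [tsum_mul_left, hw, tsum_bailey_weight hr he k, zpow_add₀ hr0]
  ring

lemma one_sub_mul_zpow_ne_zero {r c : ℂ} (hr : ‖r‖ < 1) (hc : ‖c‖ = 1) {k : ℤ}
    (hk : k ≠ 0) : 1 - c * r ^ k ≠ 0 := by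
  intro h
  have h1 : ‖c * r ^ k‖ = 1 := by rw [← sub_eq_zero.1 h, norm_one]
  rw [norm_mul, hc, one_mul, norm_zpow] at h1
  exact hk ((zpow_eq_one_iff_right₀ (norm_nonneg _) hr.ne).1 h1)

lemma one_sub_zpow_odd_ne_zero {r : ℂ} (hr0 : r ≠ 0) (hr : ‖r‖ < 1) (k : ℤ) :
    1 - r * (r ^ 2) ^ k ≠ 0 := by
  have h := one_sub_mul_zpow_ne_zero hr norm_one (k := 2 * k + 1) (by omega)
  rw [zpow_add₀ hr0, zpow_mul, zpow_one] at h
  rw [mul_comm]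
  simpa using h

/-- The Appell–Lerch series of `ω₃`. -/
theorem mockOmega3_eq {r : ℂ} (hr0 : r ≠ 0) (hr : ‖r‖ < 1) :
    mockOmega3 r = (∑' k : ℤ, (-1) ^ k * r ^ (3 * k ^ 2 + 3 * k) / (1 - r * (r ^ 2) ^ k)) /
      qPochhammerInf (r ^ 2) (r ^ 2) := by
  have h := tsum_universal_mock_theta hr0 hr hr0 (one_sub_zpow_odd_ne_zero hr0 hr) le_rfl
  rw [mockOmega3]
  convert h using 3 with n
  · rw [omega3Term, show r ^ 2 / r = r by field_simp, ← pow_mul, ← pow_two, mul_assoc]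
  · ext k
    congr 3
    push_cast
    ring

/-- The Appell–Lerch series of `f₃`. -/
theorem mockF3_sq_eq {r : ℂ} (hr0 : r ≠ 0) (hr : ‖r‖ < 1) :
    mockF3 (r ^ 2) = 2 * (∑' k : ℤ, (-1) ^ k * r ^ (3 * k ^ 2 + k) / (1 + (r ^ 2) ^ k)) /
      qPochhammerInf (r ^ 2) (r ^ 2) := by
  have hx : ∀ k : ℤ, 1 - (-1) * (r ^ 2) ^ k ≠ 0 := by
    intro k
    by_cases hk : k = 0
    · subst hk; norm_num
    · exact one_sub_mul_zpow_ne_zero (norm_sq_lt_one hr) (by simp) hk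
  have h := tsum_universal_mock_theta hr0 hr (by norm_num) hx (e := 0) (by norm_num)
  -- The 2 is the first factor of (-1; r²)_{n+1}.
  have h2 : mockF3 (r ^ 2) = 2 * ∑' n : ℕ, (r ^ 2) ^ (n * (n + 0)) /
      (qPochhammer (-1) (r ^ 2) (n + 1) * qPochhammer (r ^ 2 / -1) (r ^ 2) (n + 0)) := by
    rw [← tsum_mul_left, mockF3]
    refine tsum_congr fun n => ?_
    rw [f3Term, qPochhammer_succ', show r ^ 2 * -1 = -r ^ 2 by ring,
      show r ^ 2 / -1 = -r ^ 2 by ring, add_zero, pow_two n]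
    norm_num
    ring
  rw [h2, h, mul_div_assoc]
  congr 3
  ext k
  congr 2
  · push_cast; congr 1; ring
  · ring

/-! ### Dissections, product rules and the specialised parameters -/

lemma tsum_int_even_add_odd {f : ℤ → ℂ} (hf : Summable f) :
    ∑' k, f k = ∑' n : ℤ, f (2 * n) + ∑' n : ℤ, f (2 * n - 1) := by
  have i1 : Function.Injective fun n : ℤ => 2 * n := fun a b h => by
    simp only at h; omega
  have i2 : Function.Injective fun n : ℤ => 2 * n - 1 := fun a b h => by
    simp only at h; omega
  have h1 := (hf.comp_injective i1).hasSum
  have h2 := (hf.comp_injective i2).hasSum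
  have hc : IsCompl (Set.range fun n : ℤ => 2 * n) (Set.range fun n : ℤ => 2 * n - 1) := by
    rw [← compl_eq_iff_isCompl]
    ext k
    simp only [Set.mem_compl_iff, Set.mem_range, not_exists]
    constructor
    · intro h
      exact ⟨(k + 1) / 2, by have := h (k / 2); omega⟩
    · rintro ⟨n, rfl⟩ m
      omega
  exact ((i1.hasSum_range_iff.2 h1).add_isCompl hc (i2.hasSum_range_iff.2 h2)).tsum_eq

lemma qPochhammerInf_even_odd {q : ℂ} (hq : ‖q‖ < 1) (x : ℂ) :
    qPochhammerInf x q = qPochhammerInf x (q ^ 2) * qPochhammerInf (q * x) (q ^ 2) := by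
  have hp := norm_sq_lt_one hq
  have h1 : ∀ i : ℕ, 1 - (q ^ 2) ^ i * x = 1 - q ^ (2 * i) * x := fun i => by rw [pow_mul]
  have h2 : ∀ i : ℕ, 1 - (q ^ 2) ^ i * (q * x) = 1 - q ^ (2 * i + 1) * x := fun i => by ring
  have m1 := (multipliable_one_sub_pow_mul hp x).congr h1
  have m2 := (multipliable_one_sub_pow_mul hp (q * x)).congr h2
  rw [qPochhammerInf, qPochhammerInf, qPochhammerInf, tprod_congr h1, tprod_congr h2]
  exact (tprod_even_mul_odd (f := fun i => 1 - q ^ i * x) m1 m2).symm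

lemma qPochhammerInf_mul_neg {q : ℂ} (hq : ‖q‖ < 1) (x : ℂ) :
    qPochhammerInf x q * qPochhammerInf (-x) q = qPochhammerInf (x ^ 2) (q ^ 2) := by
  rw [qPochhammerInf, qPochhammerInf, ← (multipliable_one_sub_pow_mul hq x).tprod_mul
    (multipliable_one_sub_pow_mul hq (-x))]
  refine tprod_congr fun i => ?_
  ring

lemma one_sub_unit_mul_zpow_ne_zero {r c : ℂ} (hr : ‖r‖ < 1) (hc : ‖c‖ = 1) (hc1 : c ≠ 1)
    (k : ℤ) : 1 - c * r ^ k ≠ 0 := by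
  by_cases hk : k = 0
  · subst hk
    simpa [sub_eq_zero] using hc1.symm
  · exact one_sub_mul_zpow_ne_zero hr hc hk

/-- The parameters in the partial fraction expansion that yields Watson's identity. -/
def watsonParam (q : ℂ) : Fin 3 → ℂ := ![1, Complex.I * q, -Complex.I * q]

open Complex in
lemma watsonParam_nondegenerate {q : ℂ} (hq0 : q ≠ 0) (hq : ‖q‖ < 1) :
    (∀ i, watsonParam q i ≠ 0) ∧
    (∀ i j, i ≠ j → ∀ k : ℤ, 1 - watsonParam q j / watsonParam q i * (q ^ 2) ^ k ≠ 0) ∧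
    (∀ i, ∀ k : ℤ, 1 - watsonParam q i * q * (q ^ 2) ^ k ≠ 0) := by
  have hI1 : I ≠ 1 := fun h => by simpa using congrArg Complex.re h
  have hI2 : -I ≠ 1 := fun h => by simpa using congrArg Complex.re h
  have hI3 : (-1 : ℂ) ≠ 1 := by norm_num
  have nI1 : ‖I‖ = 1 := by simp
  have nI2 : ‖-I‖ = 1 := by simp
  have nI3 : ‖(-1 : ℂ)‖ = 1 := by simp
  have hII := Complex.I_mul_I
  -- Every quantity except b₀q = q is a power of q times one of i, -i, -1, so it never meets a power
  -- of q².
  have key : ∀ {c : ℂ}, ‖c‖ = 1 → c ≠ 1 → ∀ (k m : ℤ) {z : ℂ}, z = c * q ^ m →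
      1 - z * (q ^ 2) ^ k ≠ 0 := by
    intro c h1 h2 k m z hz
    have := one_sub_unit_mul_zpow_ne_zero hq h1 h2 (m + 2 * k)
    rwa [zpow_add₀ hq0, zpow_mul, ← mul_assoc, ← hz] at this
  have hI0 := Complex.I_ne_zero
  refine ⟨?_, ?_, ?_⟩
  · intro i
    fin_cases i <;> simp [watsonParam, hq0]
  · intro i j hij k
    fin_cases i <;> fin_cases j <;> first | exact absurd rfl hij | skip
    · exact key nI1 hI1 k 1 (by simp [watsonParam])
    · exact key nI2 hI2 k 1 (by simp [watsonParam])
    · exact key nI2 hI2 k (-1) (by simp [watsonParam]; ring)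
    · exact key nI3 hI3 k 0 (by simp [watsonParam]; field_simp)
    · exact key nI1 hI1 k (-1) (by simp [watsonParam]; ring)
    · exact key nI3 hI3 k 0 (by simp [watsonParam]; field_simp)
  · intro i k
    fin_cases i
    · simpa [watsonParam] using one_sub_zpow_odd_ne_zero hq0 hq k
    · exact key nI1 hI1 k 2 (by simp [watsonParam]; ring)
    · exact key nI2 hI2 k 2 (by simp [watsonParam]; ring)

open Complex in
lemma qPochhammerInf_I_mul_neg {q : ℂ} (hq : ‖q‖ < 1) (x : ℂ) :
    qPochhammerInf (I * x) q * qPochhammerInf (-I * x) q = qPochhammerInf (-x ^ 2) (q ^ 2) := by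
  have := qPochhammerInf_mul_neg hq (I * x)
  rwa [mul_pow, I_sq, neg_one_mul, ← neg_mul] at this

open Complex in
lemma thetaProd_I_mul {q : ℂ} (hq0 : q ≠ 0) (hq : ‖q‖ < 1) :
    thetaProd (I * q) (q ^ 2) = qPochhammerInf (-q ^ 2) (q ^ 4) ∧
    thetaProd (-I * q) (q ^ 2) = qPochhammerInf (-q ^ 2) (q ^ 4) := by
  have h := qPochhammerInf_I_mul_neg (norm_sq_lt_one hq) q
  rw [← pow_mul] at h
  have hI0 := I_ne_zero
  have hII := I_sq
  have e1 : q ^ 2 / (I * q) = -I * q := by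
    field_simp; rw [hII]; ring
  have e2 : q ^ 2 / (-I * q) = I * q := by
    field_simp; rw [hII]
  rw [thetaProd, thetaProd, e1, e2, mul_comm (qPochhammerInf (-I * q) _), h]
  exact ⟨rfl, rfl⟩

lemma thetaProd_inv {q x : ℂ} (hq : ‖q‖ < 1) (hx : x ≠ 0) :
    thetaProd x⁻¹ q = -x⁻¹ * thetaProd x q := by
  rw [thetaProd, thetaProd, qPochhammerInf_eq_one_sub_mul hq x⁻¹,
    qPochhammerInf_eq_one_sub_mul hq x, div_inv_eq_mul, ← div_eq_mul_inv]
  field_simp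
  ring

lemma thetaProd_neg_one {q : ℂ} (hq : ‖q‖ < 1) :
    thetaProd (-1) q = 2 * qPochhammerInf (-q) q ^ 2 := by
  rw [thetaProd, qPochhammerInf_eq_one_sub_mul hq (-1), mul_neg_one, div_neg, div_one]
  ring

open Complex in
lemma thetaProd_I_mul_sq {q : ℂ} (hq0 : q ≠ 0) (hq : ‖q‖ < 1) :
    thetaProd (I * q * q) (q ^ 2) * thetaProd (-I * q * q) (q ^ 2) =
      2 * qPochhammerInf (-q ^ 4) (q ^ 4) ^ 2 := by
  have hp := norm_sq_lt_one hq
  have hI0 := I_ne_zero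
  have hII := I_sq
  have h := qPochhammerInf_I_mul_neg hp (q ^ 2)
  rw [← pow_mul] at h
  norm_num at h
  have e1 : q ^ 2 / (I * q * q) = -I := by
    field_simp; rw [hII]; ring
  have e2 : q ^ 2 / (-I * q * q) = I := by
    field_simp; rw [hII]
  rw [thetaProd, thetaProd, e1, e2, qPochhammerInf_eq_one_sub_mul hp I,
    qPochhammerInf_eq_one_sub_mul hp (-I), ← h]
  have e3 : (1 - I) * (1 - -I) = 2 := by ring_nf; rw [hII]; norm_num
  have e4 : q ^ 2 * I = I * q * q := by ring
  have e5 : q ^ 2 * -I = -I * q * q := by ring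
  have e6 : I * q ^ 2 = I * q * q := by ring
  have e7 : -(I * q * q) = -I * q * q := by ring
  rw [e4, e5, e6, e7, ← e3]
  ring

lemma erase_univ_fin_three (f : Fin 3 → ℂ) :
    ∏ j ∈ Finset.univ.erase 0, f j = f 1 * f 2 ∧
    ∏ j ∈ Finset.univ.erase 1, f j = f 0 * f 2 ∧
    ∏ j ∈ Finset.univ.erase 2, f j = f 0 * f 1 := by
  refine ⟨?_, ?_, ?_⟩
  · rw [show (Finset.univ.erase 0 : Finset (Fin 3)) = {1, 2} by decide]
    simp
  · rw [show (Finset.univ.erase 1 : Finset (Fin 3)) = {0, 2} by decide]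
    simp
  · rw [show (Finset.univ.erase 2 : Finset (Fin 3)) = {0, 1} by decide]
    simp

open Complex in
-- The prefactors ±i/q come from inverting the theta argument. Against b = ±iq they leave the same
-- q², so the two families can be added.
lemma tripleDenomInf_watson {q : ℂ} (hq0 : q ≠ 0) (hq : ‖q‖ < 1) :
    tripleDenomInf q (watsonParam q) 0 =
      qPochhammerInf (q ^ 2) (q ^ 2) ^ 2 * qPochhammerInf (-q ^ 2) (q ^ 4) ^ 2 ∧
    tripleDenomInf q (watsonParam q) 1 = qPochhammerInf (q ^ 2) (q ^ 2) ^ 2 *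
      (I / q * qPochhammerInf (-q ^ 2) (q ^ 4) * (2 * qPochhammerInf (-q ^ 2) (q ^ 2) ^ 2)) ∧
    tripleDenomInf q (watsonParam q) 2 = qPochhammerInf (q ^ 2) (q ^ 2) ^ 2 *
      (-I / q * qPochhammerInf (-q ^ 2) (q ^ 4) * (2 * qPochhammerInf (-q ^ 2) (q ^ 2) ^ 2)) := by
  have hp := norm_sq_lt_one hq
  have hI0 := I_ne_zero
  have hII := I_sq
  obtain ⟨h1, h2⟩ := thetaProd_I_mul hq0 hq
  have h3 := thetaProd_inv hp (mul_ne_zero hI0 hq0)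
  have h4 := thetaProd_inv hp (mul_ne_zero (neg_ne_zero.2 hI0) hq0)
  have e1 : -(I * q)⁻¹ = I / q := by field_simp; rw [hII]
  have e2 : -(-I * q)⁻¹ = -I / q := by field_simp; rw [hII, neg_neg]
  rw [h1, e1] at h3
  rw [h2, e2] at h4
  have e3 : I * q / (-I * q) = -1 := by field_simp
  have e4 : -I * q / (I * q) = -1 := by field_simp
  obtain ⟨f1, -, -⟩ := erase_univ_fin_three
    fun j => thetaProd (watsonParam q j / watsonParam q 0) (q ^ 2)
  obtain ⟨-, f2, -⟩ := erase_univ_fin_three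
    fun j => thetaProd (watsonParam q j / watsonParam q 1) (q ^ 2)
  obtain ⟨-, -, f3⟩ := erase_univ_fin_three
    fun j => thetaProd (watsonParam q j / watsonParam q 2) (q ^ 2)
  have b0 : watsonParam q 0 = 1 := rfl
  have b1 : watsonParam q 1 = I * q := rfl
  have b2 : watsonParam q 2 = -I * q := rfl
  rw [b0, b1, b2, div_one, div_one, h1, h2] at f1
  rw [b0, b1, b2, one_div, h3, e4, thetaProd_neg_one hp] at f2
  rw [b0, b1, b2, one_div, h4, e3, thetaProd_neg_one hp] at f3
  rw [tripleDenomInf, tripleDenomInf, tripleDenomInf, b0, b1, b2, f1, f2, f3, pow_two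
    (qPochhammerInf (-q ^ 2) (q ^ 4))]
  exact ⟨rfl, rfl, rfl⟩

open Complex in
lemma tripleNumer_watson {q : ℂ} (hq0 : q ≠ 0) (k : ℤ) :
    tripleNumer q (watsonParam q) 0 k = (-1) ^ k * q ^ (3 * k ^ 2 + 3 * k) ∧
    tripleNumer q (watsonParam q) 1 k = I ^ k * q ^ (3 * k ^ 2 + 6 * k) ∧
    tripleNumer q (watsonParam q) 2 k = (-I) ^ k * q ^ (3 * k ^ 2 + 6 * k) := by
  have hI0 := I_ne_zero
  have hII := I_sq
  obtain ⟨f1, -, -⟩ := erase_univ_fin_three fun j => watsonParam q j / watsonParam q 0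
  obtain ⟨-, f2, -⟩ := erase_univ_fin_three fun j => watsonParam q j / watsonParam q 1
  obtain ⟨-, -, f3⟩ := erase_univ_fin_three fun j => watsonParam q j / watsonParam q 2
  have b0 : watsonParam q 0 = 1 := rfl
  have b1 : watsonParam q 1 = I * q := rfl
  have b2 : watsonParam q 2 = -I * q := rfl
  rw [b0, b1, b2, show I * q / 1 * (-I * q / 1) = q ^ (2 : ℤ) by
    norm_cast; ring_nf; rw [hII]; ring] at f1
  rw [b0, b1, b2, show 1 / (I * q) * (-I * q / (I * q)) = (-I * q ^ (1 : ℤ))⁻¹ by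
    rw [zpow_one]; field_simp] at f2
  rw [b0, b1, b2, show 1 / (-I * q) * (I * q / (-I * q)) = (I * q ^ (1 : ℤ))⁻¹ by
    rw [zpow_one]; field_simp] at f3
  have s1 : (-1 : ℂ) ^ k * (-I) ^ k = I ^ k := by rw [← mul_zpow]; norm_num
  have s2 : (-1 : ℂ) ^ k * I ^ k = (-I) ^ k := by rw [← mul_zpow]; norm_num
  rw [tripleNumer, tripleNumer, tripleNumer, b0, b1, b2, f1, f2, f3]
  refine ⟨?_, ?_, ?_⟩
  · rw [← zpow_mul, mul_assoc, ← zpow_add₀ hq0]; congr 2; ring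
  · rw [inv_zpow', neg_neg, mul_zpow, ← zpow_mul, mul_mul_mul_comm, s1, ← zpow_add₀ hq0]
    congr 2; ring
  · rw [inv_zpow', neg_neg, mul_zpow, ← zpow_mul, mul_mul_mul_comm, s2, ← zpow_add₀ hq0]
    congr 2; ring

lemma summable_quadratic_div_one_sub {r c x : ℂ} (hr0 : r ≠ 0) (hr : ‖r‖ < 1) (hc : c ≠ 0) :
    Summable fun k : ℤ => c ^ k * r ^ (3 * k ^ 2 + 6 * k) / (1 - x * (r ^ 2) ^ k) := by
  obtain ⟨D, hD0, hD⟩ :=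
    exists_norm_inv_one_sub_zpow_le (pow_ne_zero 2 hr0) (norm_sq_lt_one hr) x
  have h := summable_norm_zpow_quadratic hr0 hr hc (a := 3) (by norm_num) 6
  refine Summable.of_norm_bounded (h.mul_right D) fun k => ?_
  rw [div_eq_mul_inv, norm_mul, mul_comm (c ^ k)]
  exact mul_le_mul_of_nonneg_left (hD k) (norm_nonneg _)

open Complex in
lemma one_sub_I_mul_mul {y : ℂ} : (1 - I * y) * (1 - -I * y) = 1 + y ^ 2 := by
  ring_nf; rw [I_sq]; ring

open Complex in
-- For k = 2n the fractions combine to 2/(1 + y²) with y = q^{4n+2}; for k = 2n - 1, the numerators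
-- ∓i give 2y/(1 + y²) with y = q^{4n}. These are the denominators of ω₃(-q⁴) and f₃(q⁸).
lemma tsum_I_families {q : ℂ} (hq0 : q ≠ 0) (hq : ‖q‖ < 1) :
    (∑' k : ℤ, I ^ k * q ^ (3 * k ^ 2 + 6 * k) / (1 - I * q * q * (q ^ 2) ^ k)) +
      ∑' k : ℤ, (-I) ^ k * q ^ (3 * k ^ 2 + 6 * k) / (1 - -I * q * q * (q ^ 2) ^ k) =
    2 * (∑' k : ℤ, (-1) ^ k * (-(q ^ 4)) ^ (3 * k ^ 2 + 3 * k) /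
        (1 - -(q ^ 4) * ((-(q ^ 4)) ^ 2) ^ k)) +
      2 / q ^ 3 * ∑' k : ℤ, (-1) ^ k * (q ^ 4) ^ (3 * k ^ 2 + k) / (1 + ((q ^ 4) ^ 2) ^ k) := by
  have s1 := summable_quadratic_div_one_sub (x := I * q * q) hq0 hq I_ne_zero
  have s2 := summable_quadratic_div_one_sub (x := -I * q * q) hq0 hq (neg_ne_zero.2 I_ne_zero)
  obtain ⟨-, -, hne⟩ := watsonParam_nondegenerate hq0 hq
  have n1 : ∀ k : ℤ, 1 - I * (q ^ 2 * (q ^ 2) ^ k) ≠ 0 := fun k => by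
    convert hne 1 k using 2
    simp [watsonParam]; ring
  have n2 : ∀ k : ℤ, 1 - -I * (q ^ 2 * (q ^ 2) ^ k) ≠ 0 := fun k => by
    convert hne 2 k using 2
    simp [watsonParam]; ring
  have a1 : ∀ k : ℤ, I * q * q * (q ^ 2) ^ k = I * (q ^ 2 * (q ^ 2) ^ k) := fun k => by ring
  have a2 : ∀ k : ℤ, -I * q * q * (q ^ 2) ^ k = -I * (q ^ 2 * (q ^ 2) ^ k) := fun k => by ring
  rw [← s1.tsum_add s2, tsum_int_even_add_odd (s1.add s2), ← tsum_mul_left, ← tsum_mul_left]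
  simp only [a1, a2]
  have hm : (-I) ^ (2 : ℤ) = -1 := by rw [zpow_two, neg_mul_neg, I_mul_I]
  congr 1
  · refine tsum_congr fun n => ?_
    have i1 : I ^ (2 * n) = (-1) ^ n := by
      rw [zpow_mul]; congr 1; exact I_sq
    have i2 : (-I) ^ (2 * n) = (-1) ^ n := by
      rw [zpow_mul, hm]
    -- Evenness of the exponent removes the sign of the base -q⁴.
    have hev : Even (3 * n ^ 2 + 3 * n) := by
      rw [show 3 * n ^ 2 + 3 * n = 3 * (n * (n + 1)) by ring]
      exact (Int.even_mul_succ_self n).mul_left 3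
    have e1 : (-(q ^ 4)) ^ (3 * n ^ 2 + 3 * n) = q ^ (3 * (2 * n) ^ 2 + 6 * (2 * n)) := by
      rw [hev.neg_zpow, ← zpow_natCast, ← zpow_mul]; congr 1; push_cast; ring
    have e2 : 1 - -(q ^ 4) * ((-(q ^ 4)) ^ 2) ^ n = 1 + (q ^ 2 * (q ^ 2) ^ (2 * n)) ^ 2 := by
      rw [neg_sq, mul_pow, ← zpow_natCast ((q ^ 2) ^ (2 * n)), ← zpow_mul, ← zpow_natCast q 2,
        ← zpow_natCast q 4, ← zpow_natCast _ 2, ← zpow_natCast _ 2]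
      simp only [← zpow_mul]
      push_cast
      ring_nf
    rw [e1, e2, i1, i2, ← one_sub_I_mul_mul]
    have h1 := n1 (2 * n)
    have h2 := n2 (2 * n)
    generalize q ^ 2 * (q ^ 2) ^ (2 * n) = y at *
    generalize q ^ (3 * (2 * n) ^ 2 + 6 * (2 * n)) = z at *
    have h4 : 1 - -I * y = 1 + I * y := by ring
    rw [h4] at h2 ⊢
    field_simp
    ring
  · refine tsum_congr fun n => ?_
    have i1 : I ^ (2 * n - 1) = (-1) ^ n * -I := by
      rw [zpow_sub₀ I_ne_zero, zpow_mul, zpow_one, div_eq_mul_inv, inv_I]; congr 2; exact I_sq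
    have i2 : (-I) ^ (2 * n - 1) = (-1) ^ n * I := by
      rw [zpow_sub₀ (neg_ne_zero.2 I_ne_zero), zpow_mul, zpow_one, div_eq_mul_inv, inv_neg, inv_I,
        neg_neg, hm]
    have e0 : q ^ 2 * (q ^ 2) ^ (2 * n - 1) = q ^ (4 * n) := by
      rw [← zpow_one_add₀ (pow_ne_zero 2 hq0), ← zpow_natCast, ← zpow_mul]; congr 1
      push_cast; ring
    have e1 : (q ^ 4) ^ (3 * n ^ 2 + n) =
        q ^ 3 * q ^ (3 * (2 * n - 1) ^ 2 + 6 * (2 * n - 1)) * q ^ (4 * n) := by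
      rw [← zpow_natCast, ← zpow_natCast, ← zpow_mul, ← zpow_add₀ hq0, ← zpow_add₀ hq0]; congr 1
      push_cast; ring
    have e2 : 1 + ((q ^ 4) ^ 2) ^ n = 1 + (q ^ (4 * n)) ^ 2 := by
      rw [← pow_mul, ← zpow_natCast, ← zpow_natCast (q ^ (4 * n)), ← zpow_mul, ← zpow_mul]
      congr 2; push_cast; ring
    have h1 := n1 (2 * n - 1)
    have h2 := n2 (2 * n - 1)
    rw [e0] at h1 h2 ⊢
    rw [e1, e2, i1, i2, ← one_sub_I_mul_mul]
    generalize q ^ (4 * n) = y at *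
    generalize q ^ (3 * (2 * n - 1) ^ 2 + 6 * (2 * n - 1)) = z at *
    have hII := I_sq
    have h4 : 1 - -I * y = 1 + I * y := by ring
    rw [h4] at h2 ⊢
    field_simp
    ring_nf
    simp only [hII]
    ring

open Complex in
lemma inv_theta_eq_appell {q : ℂ} (hq0 : q ≠ 0) (hq : ‖q‖ < 1) :
    (q * (qPochhammerInf q (q ^ 2) ^ 2 * (2 * qPochhammerInf (-q ^ 4) (q ^ 4) ^ 2)))⁻¹ =
      (∑' k : ℤ, (-1) ^ k * q ^ (3 * k ^ 2 + 3 * k) / (1 - q * (q ^ 2) ^ k)) /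
        (qPochhammerInf (q ^ 2) (q ^ 2) ^ 2 * qPochhammerInf (-q ^ 2) (q ^ 4) ^ 2) +
      q ^ 2 / (qPochhammerInf (q ^ 2) (q ^ 2) ^ 2 *
        (qPochhammerInf (-q ^ 2) (q ^ 4) * (2 * qPochhammerInf (-q ^ 2) (q ^ 2) ^ 2))) *
      (2 * (∑' k : ℤ, (-1) ^ k * (-(q ^ 4)) ^ (3 * k ^ 2 + 3 * k) /
        (1 - -(q ^ 4) * ((-(q ^ 4)) ^ 2) ^ k)) +
      2 / q ^ 3 * ∑' k : ℤ, (-1) ^ k * (q ^ 4) ^ (3 * k ^ 2 + k) / (1 + ((q ^ 4) ^ 2) ^ k)) := by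
  obtain ⟨hb, hbb, hx⟩ := watsonParam_nondegenerate hq0 hq
  have key := inv_prod_thetaProd hq0 hq hq0 (watsonParam q) hb hbb hx
  obtain ⟨d0, d1, d2⟩ := tripleDenomInf_watson hq0 hq
  have b0 : watsonParam q 0 = 1 := rfl
  have b1 : watsonParam q 1 = I * q := rfl
  have b2 : watsonParam q 2 = -I * q := rfl
  have t0 : thetaProd q (q ^ 2) = qPochhammerInf q (q ^ 2) ^ 2 := by
    rw [thetaProd, show q ^ 2 / q = q by field_simp, ← pow_two]
  rw [Fin.prod_univ_three, Fin.sum_univ_three, b0, b1, b2, d0, d1, d2, mul_assoc (thetaProd _ _),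
    thetaProd_I_mul_sq hq0 hq, one_mul, one_mul, t0] at key
  simp only [(tripleNumer_watson hq0 _).1, (tripleNumer_watson hq0 _).2.1,
    (tripleNumer_watson hq0 _).2.2, div_right_comm _ (qPochhammerInf _ _ ^ 2 * _)] at key
  rw [tsum_div_const, tsum_div_const, tsum_div_const] at key
  rw [key, ← tsum_I_families hq0 hq, add_assoc]
  congr 1
  have hI0 := I_ne_zero
  have hII := I_sq
  simp only [div_eq_mul_inv, mul_inv, inv_inv, inv_I, inv_neg]
  ring_nf
  simp only [hII]
  ring

/-! ### Convergence and nonvanishing -/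

lemma one_sub_pow_mul_neg_ne_zero {q : ℂ} (hq : ‖q‖ < 1) (i : ℕ) : 1 - q ^ i * -q ≠ 0 :=
  one_sub_pow_mul_ne_zero_of_norm_lt hq (by rwa [norm_neg]) i

lemma one_sub_sq_pow_mul_ne_zero {q : ℂ} (hq : ‖q‖ < 1) (i : ℕ) : 1 - (q ^ 2) ^ i * q ≠ 0 :=
  one_sub_pow_mul_ne_zero_of_norm_lt (norm_sq_lt_one hq) hq i

lemma summable_norm_f3Term {q : ℂ} (hq : ‖q‖ < 1) : Summable fun n => ‖f3Term q n‖ := by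
  obtain ⟨C, hC0, hC⟩ := exists_norm_inv_qPochhammer_le hq (one_sub_pow_mul_neg_ne_zero hq)
  refine Summable.of_nonneg_of_le (fun _ => norm_nonneg _) (fun n => ?_)
    ((summable_geometric_of_lt_one (norm_nonneg q) hq).mul_right (C ^ 2))
  rw [f3Term, div_eq_mul_inv, ← inv_pow, norm_mul, norm_pow, norm_pow]
  exact mul_le_mul (pow_le_pow_of_le_one (norm_nonneg _) hq.le (Nat.le_self_pow two_ne_zero n))
    (pow_le_pow_left₀ (norm_nonneg _) (hC n) 2) (by positivity) (by positivity)

lemma summable_norm_omega3Term {q : ℂ} (hq : ‖q‖ < 1) : Summable fun n => ‖omega3Term q n‖ := by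
  obtain ⟨C, hC0, hC⟩ :=
    exists_norm_inv_qPochhammer_le (norm_sq_lt_one hq) (one_sub_sq_pow_mul_ne_zero hq)
  refine Summable.of_nonneg_of_le (fun _ => norm_nonneg _) (fun n => ?_)
    ((summable_geometric_of_lt_one (norm_nonneg q) hq).mul_right (C ^ 2))
  rw [omega3Term, div_eq_mul_inv, ← inv_pow, norm_mul, norm_pow, norm_pow]
  exact mul_le_mul (pow_le_pow_of_le_one (norm_nonneg _) hq.le (by nlinarith [Nat.zero_le (n * n)]))
    (pow_le_pow_left₀ (norm_nonneg _) (hC _) 2) (by positivity) (by positivity)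

lemma eulerFactor_eq (a : ℕ) (q : ℂ) (i : ℕ) : eulerFactor a q i = 1 - (q ^ a) ^ i * q ^ a := by
  rw [eulerFactor, pow_mul, pow_succ]

lemma eulerJ_eq_qPochhammerInf (a : ℕ) (q : ℂ) : eulerJ a q = qPochhammerInf (q ^ a) (q ^ a) :=
  tprod_congr (eulerFactor_eq a q)

lemma norm_pow_lt_one {q : ℂ} (hq : ‖q‖ < 1) {a : ℕ} (ha : 0 < a) : ‖q ^ a‖ < 1 := by
  rw [norm_pow]; exact pow_lt_one₀ (norm_nonneg _) hq ha.ne'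

lemma multipliable_eulerFactor {q : ℂ} (hq : ‖q‖ < 1) {a : ℕ} (ha : 0 < a) :
    Multipliable (eulerFactor a q) :=
  (multipliable_one_sub_pow_mul (norm_pow_lt_one hq ha) (q ^ a)).congr
    fun i => (eulerFactor_eq a q i).symm

lemma eulerJ_ne_zero {q : ℂ} (hq : ‖q‖ < 1) {a : ℕ} (ha : 0 < a) : eulerJ a q ≠ 0 := by
  rw [eulerJ_eq_qPochhammerInf]
  exact qPochhammerInf_ne_zero (norm_pow_lt_one hq ha)
    (one_sub_pow_mul_self_ne_zero (norm_pow_lt_one hq ha))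

lemma eulerJ_zero {a : ℕ} (ha : 0 < a) : eulerJ a 0 = 1 := by
  have h : ∀ i, eulerFactor a 0 i = 1 := fun i => by
    rw [eulerFactor, zero_pow (by positivity), sub_zero]
  rw [eulerJ, tprod_congr h, tprod_one]

lemma mockF3_zero : mockF3 0 = 1 := by
  rw [mockF3, tsum_eq_single 0]
  · simp [f3Term, qPochhammer_zero]
  · intro n hn
    simp [f3Term, hn]

/-! ### Assembly of the identity -/

lemma watson_identity_of_ne_zero {q : ℂ} (hq0 : q ≠ 0) (hq : ‖q‖ < 1) :
    mockF3 (q ^ 8) + 2 * q * mockOmega3 q + 2 * q ^ 3 * mockOmega3 (-(q ^ 4)) =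
      eulerJ 2 q * eulerJ 4 q ^ 6 / (eulerJ 1 q ^ 2 * eulerJ 8 q ^ 4) := by
  have h2 : ‖q ^ 2‖ < 1 := norm_pow_lt_one hq (by norm_num)
  have h4 : ‖q ^ 4‖ < 1 := norm_pow_lt_one hq (by norm_num)
  have hf := mockF3_sq_eq (pow_ne_zero 4 hq0) h4
  have hω := mockOmega3_eq hq0 hq
  have hω' := mockOmega3_eq (neg_ne_zero.2 (pow_ne_zero 4 hq0)) (by rwa [norm_neg])
  have key := inv_theta_eq_appell hq0 hq
  have r1 := qPochhammerInf_even_odd hq q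
  have r2 := qPochhammerInf_even_odd h2 (q ^ 2)
  have r4 := qPochhammerInf_even_odd h4 (q ^ 4)
  have rE := qPochhammerInf_mul_neg h4 (q ^ 2)
  have rF := qPochhammerInf_mul_neg h2 (q ^ 2)
  have rG := qPochhammerInf_mul_neg h4 (q ^ 4)
  have n1 := eulerJ_ne_zero hq (a := 1) (by norm_num)
  have n2 := eulerJ_ne_zero hq (a := 2) (by norm_num)
  have n4 := eulerJ_ne_zero hq (a := 4) (by norm_num)
  have n8 := eulerJ_ne_zero hq (a := 8) (by norm_num)
  simp only [eulerJ_eq_qPochhammerInf, pow_one] at n1 n2 n4 n8 ⊢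
  have p8 : (q ^ 4) ^ 2 = q ^ 8 := by ring
  have p8' : (-q ^ 4) ^ 2 = q ^ 8 := by ring
  have p4 : (q ^ 2) ^ 2 = q ^ 4 := by ring
  have m2 : q * q = q ^ 2 := by ring
  have m4 : q ^ 2 * q ^ 2 = q ^ 4 := by ring
  have m8 : q ^ 4 * q ^ 4 = q ^ 8 := by ring
  rw [m2] at r1
  rw [p4, m4] at r2
  rw [p8, m8] at r4
  rw [p4, p8] at rE
  rw [p4] at rF
  rw [p8] at rG hf
  rw [p8'] at hω'
  rw [p8, p8'] at key
  rw [hf, hω, hω']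
  generalize (∑' k : ℤ, (-1) ^ k * q ^ (3 * k ^ 2 + 3 * k) / (1 - q * (q ^ 2) ^ k)) = B at *
  generalize (∑' k : ℤ, (-1) ^ k * (-(q ^ 4)) ^ (3 * k ^ 2 + 3 * k) /
        (1 - -(q ^ 4) * (q ^ 8) ^ k)) = A₂ at *
  generalize (∑' k : ℤ, (-1) ^ k * (q ^ 4) ^ (3 * k ^ 2 + k) / (1 + (q ^ 8) ^ k)) = A₁ at *
  generalize qPochhammerInf q q = J₁ at *
  generalize qPochhammerInf (q ^ 2) (q ^ 2) = J₂ at *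
  generalize qPochhammerInf (q ^ 4) (q ^ 4) = J₄ at *
  generalize qPochhammerInf (q ^ 8) (q ^ 8) = J₈ at *
  generalize qPochhammerInf q (q ^ 2) = D₁ at *
  generalize qPochhammerInf (q ^ 2) (q ^ 4) = D₂ at *
  generalize qPochhammerInf (q ^ 4) (q ^ 8) = D₄ at *
  generalize qPochhammerInf (-q ^ 2) (q ^ 4) = E at *
  generalize qPochhammerInf (-q ^ 2) (q ^ 2) = F at *
  generalize qPochhammerInf (-q ^ 4) (q ^ 4) = G at *
  have hD₂ : D₂ = J₂ / J₄ := by rw [eq_div_iff n4, r2]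
  have hD₄ : D₄ = J₄ / J₈ := by rw [eq_div_iff n8, r4]
  have hE : E = J₄ ^ 2 / (J₂ * J₈) := by
    rw [hD₂, hD₄] at rE
    field_simp at rE ⊢
    linear_combination rE
  have hF : F = J₄ / J₂ := by rw [eq_div_iff n2, ← rF]; ring
  have hG : G = J₈ / J₄ := by rw [eq_div_iff n4, ← rG]; ring
  have hD₁ : D₁ = J₁ / J₂ := by rw [eq_div_iff n2, r1]
  -- The multiplier 2qE²J₂ normalises the ω₃(q) term; the relation E J₈ = J₂F² makes it fit the
  -- other two as well.
  have e1 : 2 * A₁ / J₈ + 2 * q * (B / J₂) + 2 * q ^ 3 * (A₂ / J₈) = 2 * q * E ^ 2 * J₂ *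
      (B / (J₂ ^ 2 * E ^ 2) + q ^ 2 / (J₂ ^ 2 * (E * (2 * F ^ 2))) *
        (2 * A₂ + 2 / q ^ 3 * A₁)) := by
    rw [hE, hF]
    field_simp
    ring
  rw [e1, ← key, hE, hG, hD₁]
  field_simp

end

theorem mainTheorem3 (q : ℂ) (hq : ‖q‖ < 1) :
    -- the three series converge absolutely, with nonvanishing denominators
    (∀ n : ℕ, qPochhammer (-(q ^ 8)) (q ^ 8) n ≠ 0) ∧
    (∀ n : ℕ, qPochhammer q (q ^ 2) n ≠ 0) ∧
    (∀ n : ℕ, qPochhammer (-(q ^ 4)) ((-(q ^ 4)) ^ 2) n ≠ 0) ∧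
    Summable (fun n : ℕ => ‖f3Term (q ^ 8) n‖) ∧
    Summable (fun n : ℕ => ‖omega3Term q n‖) ∧
    Summable (fun n : ℕ => ‖omega3Term (-(q ^ 4)) n‖) ∧
    -- the infinite products converge to nonzero values
    (∀ a : ℕ, 0 < a → Multipliable (eulerFactor a q) ∧ eulerJ a q ≠ 0) ∧
    -- Watson's identity
    mockF3 (q ^ 8) + 2 * q * mockOmega3 q + 2 * q ^ 3 * mockOmega3 (-(q ^ 4)) =
      eulerJ 2 q * eulerJ 4 q ^ 6 / (eulerJ 1 q ^ 2 * eulerJ 8 q ^ 4) := by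
  have h8 : ‖q ^ 8‖ < 1 := norm_pow_lt_one hq (by norm_num)
  have h4 : ‖-(q ^ 4)‖ < 1 := by rw [norm_neg]; exact norm_pow_lt_one hq (by norm_num)
  refine ⟨qPochhammer_ne_zero (one_sub_pow_mul_neg_ne_zero h8),
    qPochhammer_ne_zero (one_sub_sq_pow_mul_ne_zero hq),
    qPochhammer_ne_zero (one_sub_sq_pow_mul_ne_zero h4), summable_norm_f3Term h8,
    summable_norm_omega3Term hq, summable_norm_omega3Term h4,
    fun a ha => ⟨multipliable_eulerFactor hq ha, eulerJ_ne_zero hq ha⟩, ?_⟩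
  -- The expansions use negative powers of q, so q = 0 is separate; both sides are then 1.
  by_cases hq0 : q = 0
  · subst hq0
    rw [eulerJ_zero one_pos, eulerJ_zero two_pos, eulerJ_zero four_pos, eulerJ_zero (by norm_num),
      zero_pow (by norm_num), mockF3_zero]
    norm_num
  · exact watson_identity_of_ne_zero hq0 hq
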